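/- Fix integers $r\ge 2$ and $d\ge 3$. Let $\mathcal{G}_d$ be the class of finite simple graphs with no induced path on $d$ vertices. An instance of $K_{1,r}$-Packing restricted to $\mathcal{G}_d$ is a pair $(G,k)$ with $G\in\mathcal{G}_d$ and $k$ a nonnegative integer (the parameter); it is a Yes-instance if $G$ contains $k$ pairwise vertex-disjoint subgraphs isomorphic to the star $K_{1,r}$. This problem has a kernel with $O(k)$ vertices: there is an algorithm that maps each instance $(G,k)$ with $G\in\mathcal{G}_d$, in time polynomial in the input size (the length of the adjacency matrix of $G$ plus the number of binary digits of $k$), to an instance $(G',k')$ with $G'\in\mathcal{G}_d$ such that $(G,k)$ is a Yes-instance if and only if $(G',k')$ is, such that $k'$ plus the size of $G'$ is bounded by a function of $k$, and such that $$|V(G')|\le \max(k-1,0)\,(r+1)\,(r^{d+1}+1).$$ The degree and coefficients of the polynomial may depend on $r$ and $d$. -/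

import Mathlib

/-! ### Machine model: random access machines with a step count -/

namespace RAM

/-- Memory of a random access machine: registers `reg i` and random access memories `arr a`,
whose cells are addressed by natural numbers. A program mentions only finitely many of each. -/
structure State where
  reg : ℕ → ℕ
  arr : ℕ → ℕ → ℕ

/-- Arithmetic expressions. There is deliberately no multiplication: the machine charges one step
per operation, and with addition and truncated subtraction only, this is polynomially
related to time on Turing machines. -/
inductive Expr where
  | const (c : ℕ)
  | reg (i : ℕ)
  | get (a : ℕ) (addr : Expr)
  | add (e₁ e₂ : Expr)
  | sub (e₁ e₂ : Expr)

/-- Value of an expression. -/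
def Expr.eval (s : State) : Expr → ℕ
  | const c => c
  | reg i => s.reg i
  | get a addr => s.arr a (addr.eval s)
  | add e₁ e₂ => e₁.eval s + e₂.eval s
  | sub e₁ e₂ => e₁.eval s - e₂.eval s

/-- Number of steps for evaluating an expression: one per symbol. -/
def Expr.cost : Expr → ℕ
  | const _ => 1
  | reg _ => 1
  | get _ addr => addr.cost + 1
  | add e₁ e₂ => e₁.cost + e₂.cost + 1
  | sub e₁ e₂ => e₁.cost + e₂.cost + 1

/-- Overwrite register `i` by `v`. -/
def State.setReg (s : State) (i v : ℕ) : State :=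
  { s with reg := Function.update s.reg i v }

/-- Overwrite cell `j` of memory `a` by `v`. -/
def State.setArr (s : State) (a j v : ℕ) : State :=
  { s with arr := Function.update s.arr a (Function.update (s.arr a) j v) }

/-- Programs. Tests check whether an expression has a nonzero value. -/
inductive Prog where
  | skip
  | assign (i : ℕ) (e : Expr)
  | store (a : ℕ) (addr e : Expr)
  | seq (p q : Prog)
  | ite (e : Expr) (p q : Prog)
  | while (e : Expr) (p : Prog)

/-- `Exec p s t s'`: the program `p`, started in `s`, halts after exactly `t` steps in `s'`. -/
inductive Exec : Prog → State → ℕ → State → Prop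
  | skip (s : State) : Exec Prog.skip s 1 s
  | assign (i : ℕ) (e : Expr) (s : State) :
      Exec (Prog.assign i e) s (e.cost + 1) (s.setReg i (e.eval s))
  | store (a : ℕ) (addr e : Expr) (s : State) :
      Exec (Prog.store a addr e) s (addr.cost + e.cost + 1)
        (s.setArr a (addr.eval s) (e.eval s))
  | seq {p q : Prog} {s s₁ s₂ : State} {t₁ t₂ : ℕ} (h₁ : Exec p s t₁ s₁) (h₂ : Exec q s₁ t₂ s₂) :
      Exec (Prog.seq p q) s (t₁ + t₂) s₂
  | ite_true {e : Expr} {p q : Prog} {s s' : State} {t : ℕ} (he : e.eval s ≠ 0)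
      (h : Exec p s t s') : Exec (Prog.ite e p q) s (e.cost + 1 + t) s'
  | ite_false {e : Expr} {p q : Prog} {s s' : State} {t : ℕ} (he : e.eval s = 0)
      (h : Exec q s t s') : Exec (Prog.ite e p q) s (e.cost + 1 + t) s'
  | while_false {e : Expr} {p : Prog} {s : State} (he : e.eval s = 0) :
      Exec (Prog.while e p) s (e.cost + 1) s
  | while_true {e : Expr} {p : Prog} {s s₁ s₂ : State} {t₁ t₂ : ℕ} (he : e.eval s ≠ 0)
      (h₁ : Exec p s t₁ s₁) (h₂ : Exec (Prog.while e p) s₁ t₂ s₂) :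
      Exec (Prog.while e p) s (e.cost + 1 + t₁ + t₂) s₂

/-- Content of a memory cell that holds a letter; `0` is the blank. -/
def cell : Option Bool → ℕ
  | none => 0
  | some false => 1
  | some true => 2

/-- The state that presents the input `(x, k)` to a program: the letters of `x` are in memory `0`,
the length of `x` is in register `0`, the number `k` is in register `1`, all else is `0`. -/
def init (x : List Bool) (k : ℕ) : State where
  reg i := if i = 0 then x.length else if i = 1 then k else 0
  arr a i := if a = 0 then cell x[i]? else 0

/-- The state `s` presents the output `(y, k)`. As the letters are nonzero,
each of them has to be written (or has to be in place already). -/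
def Outputs (s : State) (y : List Bool) (k : ℕ) : Prop :=
  s.reg 0 = y.length ∧ s.reg 1 = k ∧ ∀ i < y.length, s.arr 0 i = cell y[i]?

end RAM

/-! ### Parameterized problems and kernelizations -/

/-- A parameterized problem, possibly restricted to a class of instances: each instance is a word
over the alphabet `Bool` together with a natural number, the parameter. -/
structure ParamProblem where
  Inst : Type
  word : Inst → List Bool
  param : Inst → ℕ
  Yes : Inst → Prop

/-- `κ` is computed by a program that halts on each instance `(x, k)` within a number of steps
polynomial in the length of `x` and the number of binary digits of `k`. -/
def PolyTimeComputable (Q : ParamProblem) (κ : Q.Inst → Q.Inst) : Prop :=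
  ∃ (P : RAM.Prog) (p : Polynomial ℕ), ∀ I : Q.Inst, ∃ (t : ℕ) (s : RAM.State),
    RAM.Exec P (RAM.init (Q.word I) (Q.param I)) t s ∧
    t ≤ p.eval ((Q.word I).length + Nat.size (Q.param I)) ∧
    RAM.Outputs s (Q.word (κ I)) (Q.param (κ I))

/-- A kernelization: a polynomial-time map on instances that preserves the answer and whose
output has parameter and length bounded by a function of the input parameter. -/
structure IsKernelization (Q : ParamProblem) (κ : Q.Inst → Q.Inst) : Prop where
  polyTime : PolyTimeComputable Q κ
  yes_iff : ∀ I, Q.Yes I ↔ Q.Yes (κ I)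
  bounded : ∃ g : ℕ → ℕ, ∀ I, Q.param (κ I) + (Q.word (κ I)).length ≤ g (Q.param I)

/-! ### Star packing in graphs without long induced paths -/

/-- `G` has `k` pairwise vertex-disjoint (not necessarily induced) copies of `H`. -/
def HasPacking {V W : Type*} (H : SimpleGraph V) (G : SimpleGraph W) (k : ℕ) : Prop :=
  ∃ f : Fin k → H.Copy G, Pairwise fun i j => Disjoint (Set.range (f i)) (Set.range (f j))

/-- The star `K_{1,r}`. -/
abbrev rStar (r : ℕ) : SimpleGraph (Fin 1 ⊕ Fin r) := completeBipartiteGraph (Fin 1) (Fin r)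

/-- An instance `(G, k)`, where `G` has no induced path on `d` vertices. -/
structure PackingInstance (d : ℕ) where
  n : ℕ
  G : SimpleGraph (Fin n)
  noInducedPath : ¬ (SimpleGraph.pathGraph d).IsIndContained G
  k : ℕ

open Classical in
/-- The adjacency matrix of a graph, row by row, as a word of length `n * n`:
the letter at position `i * n + j` tells whether `i` and `j` are adjacent. -/
noncomputable def adjWord {n : ℕ} (G : SimpleGraph (Fin n)) : List Bool :=
  List.ofFn fun p : Fin (n * n) => decide (G.Adj p.divNat p.modNat)

/-- `K_{1,r}`-Packing, restricted to graphs with no induced path on `d` vertices. -/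
noncomputable def starPacking (r d : ℕ) : ParamProblem where
  Inst := PackingInstance d
  word I := adjWord I.G
  param I := I.k
  Yes I := HasPacking (rStar r) I.G I.k

/-! ### Loop programs: a total sublanguage of the machine language -/

/-! Mathematical core. Pack disjoint stars greedily and let `S` be the vertex set of the resulting
maximal family of `m` stars, so `|S| = m(r+1)`. If `m ≥ k`, a trivial yes-instance is output.
Otherwise `m ≤ k-1`. By maximality every vertex outside `S` has fewer than `r` neighbors outside
`S`. Since a geodesic is an induced path, the components of `G - S` have small diameter, hence at
most `r^d` vertices each (`exists_component_card_le`).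

Only the number of components is still unbounded. Assign components to adjacent vertices of `S`, at
most `r` to each, improving the assignment by alternating paths as in bipartite matching. When no
improvement is left, let `D` be the set of vertices of `S` that alternating paths reach from
unassigned components. Each vertex of `D` has `r` components, and no component that is unassigned or
assigned to `D` has a neighbor in `S \ D` (`matching_run`). Delete `D` with all these components and
lower `k` by `|D|`.

This is safe (`pack_range_iff`). The deleted part contains `|D|` disjoint stars: each `x` in `D`
with one neighbor in each of its `r` components (`pack_full`). Conversely, at most `|D|` stars of a
packing meet `D`. Any other star lies entirely in the kept part, or else entirely in deleted
components, where its center would have `r` neighbors outside `S`. What is kept lies in `S` together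
with at most `r` components per vertex of `S`, so it has at most `|S|(1 + r·r^d)` vertices
(`card_kept_le`).

Polynomial time. The algorithm is written with `for`-loops only. For such programs `exec_toProg`
gives termination and a polynomial step bound once and for all, so correctness can be proved about
the total function `run`, with loop invariants (`loop_induction`) and syntactic frame conditions
(`frame_run`). `kernelize_run` joins the algorithm and the mathematics. -/

namespace RAM

/-- Programs whose only loops are `for`-loops over a register `i`, from `0` up to the content of a
fixed limit register, which is a parameter of the semantics. -/
inductive LoopProg where
  | skip
  | assign (i : ℕ) (e : Expr)
  | store (a : ℕ) (addr e : Expr)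
  | seq (p q : LoopProg)
  | ite (e : Expr) (p q : LoopProg)
  | loop (i : ℕ) (p : LoopProg)

namespace LoopProg

/-- Translation to machine programs; `l` is the limit register. -/
def toProg (l : ℕ) : LoopProg → Prog
  | skip => .skip
  | assign i e => .assign i e
  | store a addr e => .store a addr e
  | seq p q => .seq (p.toProg l) (q.toProg l)
  | ite e p q => .ite e (p.toProg l) (q.toProg l)
  | loop i p => .seq (.assign i (.const 0)) (.while (.sub (.reg l) (.reg i))
      (.seq (p.toProg l) (.assign i (.add (.reg i) (.const 1)))))

/-- The state in which a loop program halts. -/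
def run (l : ℕ) : LoopProg → State → State
  | skip => fun s => s
  | assign i e => fun s => s.setReg i (e.eval s)
  | store a addr e => fun s => s.setArr a (addr.eval s) (e.eval s)
  | seq p q => fun s => q.run l (p.run l s)
  | ite e p q => fun s => if e.eval s ≠ 0 then p.run l s else q.run l s
  -- The counter is advanced from its value before the body. This agrees with the machine exactly
  -- because `wf` forbids the body to change the counter.
  | loop i p => fun s => (fun s' => (p.run l s').setReg i (s'.reg i + 1))^[s.reg l] (s.setReg i 0)

/-- Whether a program may change register `x`. -/
def writesReg : LoopProg → ℕ → Bool
  | skip, _ => false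
  | assign i _, x => x == i
  | store _ _ _, _ => false
  | seq p q, x => p.writesReg x || q.writesReg x
  | ite _ p q, x => p.writesReg x || q.writesReg x
  | loop i p, x => x == i || p.writesReg x

/-- Whether a program may change memory `x`. -/
def writesArr : LoopProg → ℕ → Bool
  | skip, _ => false
  | assign _ _, _ => false
  | store a _ _, x => x == a
  | seq p q, x => p.writesArr x || q.writesArr x
  | ite _ p q, x => p.writesArr x || q.writesArr x
  | loop _ p, x => p.writesArr x

/-- No loop body changes its loop counter. -/
def wf : LoopProg → Bool
  | skip => true
  | assign _ _ => true
  | store _ _ _ => true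
  | seq p q => p.wf && q.wf
  | ite _ p q => p.wf && q.wf
  | loop i p => !p.writesReg i && p.wf

open Polynomial in
/-- A bound on the number of steps, as a polynomial in the content of the limit register. -/
noncomputable def timeBound : LoopProg → Polynomial ℕ
  | skip => C 1
  | assign _ e => C (e.cost + 1)
  | store _ addr e => C (addr.cost + e.cost + 1)
  | seq p q => p.timeBound + q.timeBound
  | ite e p q => C (e.cost + 1) + (p.timeBound + q.timeBound)
  | loop _ p => C 6 + X * (p.timeBound + C 8)

end LoopProg

/-! ### Frames, running time and loop invariants -/

@[simp] theorem State.setReg_reg (s : State) (i v j : ℕ) :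
    (s.setReg i v).reg j = if j = i then v else s.reg j := by
  simp [State.setReg, Function.update_apply]

@[simp] theorem State.setReg_arr (s : State) (i v : ℕ) : (s.setReg i v).arr = s.arr := rfl

@[simp] theorem State.setArr_reg (s : State) (a j v : ℕ) : (s.setArr a j v).reg = s.reg := rfl

@[simp] theorem State.setArr_arr (s : State) (a j v b : ℕ) :
    (s.setArr a j v).arr b = if b = a then Function.update (s.arr a) j v else s.arr b := by
  simp [State.setArr, Function.update_apply]

/-- `s'` agrees with `s` outside of what `p` may change. -/
structure Frame (p : LoopProg) (s s' : State) : Prop where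
  reg : ∀ x, p.writesReg x = false → s'.reg x = s.reg x
  arr : ∀ a, p.writesArr a = false → s'.arr a = s.arr a

/-- The write sets are computed as Booleans, so for concrete programs each claim that a register or
memory is untouched reduces to `rfl`. This carries facts across phases and loop iterations. -/
theorem frame_run (l : ℕ) (p : LoopProg) (s : State) : Frame p s (p.run l s) := by
  induction p generalizing s with
  | skip => exact ⟨fun _ _ => rfl, fun _ _ => rfl⟩
  | assign i e =>
    refine ⟨fun x hx => ?_, fun _ _ => rfl⟩
    simp only [LoopProg.writesReg, beq_eq_false_iff_ne] at hx
    simp [LoopProg.run, hx]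
  | store a addr e =>
    refine ⟨fun _ _ => rfl, fun x hx => ?_⟩
    simp only [LoopProg.writesArr, beq_eq_false_iff_ne] at hx
    simp [LoopProg.run, hx]
  | seq p q ihp ihq =>
    refine ⟨fun x hx => ?_, fun x hx => ?_⟩
    · simp only [LoopProg.writesReg, Bool.or_eq_false_iff] at hx
      exact ((ihq _).reg x hx.2).trans ((ihp s).reg x hx.1)
    · simp only [LoopProg.writesArr, Bool.or_eq_false_iff] at hx
      exact ((ihq _).arr x hx.2).trans ((ihp s).arr x hx.1)
  | ite e p q ihp ihq =>
    refine ⟨fun x hx => ?_, fun x hx => ?_⟩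
    · simp only [LoopProg.writesReg, Bool.or_eq_false_iff] at hx
      simp only [LoopProg.run]
      split_ifs
      exacts [(ihp s).reg x hx.1, (ihq s).reg x hx.2]
    · simp only [LoopProg.writesArr, Bool.or_eq_false_iff] at hx
      simp only [LoopProg.run]
      split_ifs
      exacts [(ihp s).arr x hx.1, (ihq s).arr x hx.2]
  | loop i p ih =>
    refine ⟨fun x hx => ?_, fun x hx => ?_⟩
    · simp only [LoopProg.writesReg, Bool.or_eq_false_iff, beq_eq_false_iff_ne] at hx
      simp only [LoopProg.run]
      generalize s.reg l = m
      induction m with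
      | zero => simp [hx.1]
      | succ m ihm => rw [Function.iterate_succ_apply']; simp [hx.1, (ih _).reg x hx.2, ihm]
    · simp only [LoopProg.writesArr] at hx
      simp only [LoopProg.run]
      generalize s.reg l = m
      induction m with
      | zero => simp
      | succ m ihm => rw [Function.iterate_succ_apply']; simp [(ih _).arr x hx, ihm]

/-- Loop programs halt within the time bound. -/
theorem exec_toProg (l : ℕ) (p : LoopProg) (hw : p.wf = true) (hl : p.writesReg l = false)
    (s : State) :
    ∃ t, Exec (p.toProg l) s t (p.run l s) ∧ t ≤ p.timeBound.eval (s.reg l) := by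
  induction p generalizing s with
  | skip => exact ⟨_, .skip s, by simp [LoopProg.timeBound]⟩
  | assign i e => exact ⟨_, .assign i e s, by simp [LoopProg.timeBound]⟩
  | store a addr e => exact ⟨_, .store a addr e s, by simp [LoopProg.timeBound]⟩
  | seq p q ihp ihq =>
    simp only [LoopProg.wf, Bool.and_eq_true] at hw
    simp only [LoopProg.writesReg, Bool.or_eq_false_iff] at hl
    obtain ⟨t₁, h₁, b₁⟩ := ihp hw.1 hl.1 s
    obtain ⟨t₂, h₂, b₂⟩ := ihq hw.2 hl.2 (p.run l s)
    rw [(frame_run l p s).reg l hl.1] at b₂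
    exact ⟨_, .seq h₁ h₂, by simp only [LoopProg.timeBound, Polynomial.eval_add]; omega⟩
  | ite e p q ihp ihq =>
    simp only [LoopProg.wf, Bool.and_eq_true] at hw
    simp only [LoopProg.writesReg, Bool.or_eq_false_iff] at hl
    obtain ⟨t₁, h₁, b₁⟩ := ihp hw.1 hl.1 s
    obtain ⟨t₂, h₂, b₂⟩ := ihq hw.2 hl.2 s
    by_cases he : e.eval s = 0
    · have h : (LoopProg.ite e p q).run l s = q.run l s := by simp [LoopProg.run, he]
      refine ⟨e.cost + 1 + t₂, h ▸ Exec.ite_false he h₂, ?_⟩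
      simp only [LoopProg.timeBound, Polynomial.eval_add, Polynomial.eval_C]; omega
    · have h : (LoopProg.ite e p q).run l s = p.run l s := by simp [LoopProg.run, he]
      refine ⟨e.cost + 1 + t₁, h ▸ Exec.ite_true he h₁, ?_⟩
      simp only [LoopProg.timeBound, Polynomial.eval_add, Polynomial.eval_C]; omega
  | loop i p ih =>
    simp only [LoopProg.wf, Bool.and_eq_true, Bool.not_eq_true'] at hw
    simp only [LoopProg.writesReg, Bool.or_eq_false_iff, beq_eq_false_iff_ne] at hl
    -- Testing the guard costs 4 and advancing the counter costs 4, hence 8 per round besides the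
    -- body. The final failing test gives the summand 4; initializing the counter adds 2, which
    -- makes the 6 in `timeBound`.
    have key : ∀ (m : ℕ) (s' : State), s'.reg l = s.reg l → s'.reg i + m = s.reg l →
        ∃ t, Exec (.while (.sub (.reg l) (.reg i))
          (.seq (p.toProg l) (.assign i (.add (.reg i) (.const 1))))) s' t
          ((fun s' => (p.run l s').setReg i (s'.reg i + 1))^[m] s') ∧
          t ≤ 4 + m * (p.timeBound.eval (s.reg l) + 8) := by
      intro m
      induction m with
      | zero =>
        intro s' h1 h2
        exact ⟨_, .while_false (by simp [Expr.eval]; omega), by simp [Expr.cost]⟩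
      | succ m ihm =>
        intro s' h1 h2
        obtain ⟨t, ht, bt⟩ := ih hw.2 hl.2 s'
        have hi := (frame_run l p s').reg i hw.1
        have hll := (frame_run l p s').reg l hl.2
        obtain ⟨t', ht', bt'⟩ := ihm ((p.run l s').setReg i (s'.reg i + 1))
          (by simp [hl.1, hll, h1]) (by simp; omega)
        have hb : Exec (.seq (p.toProg l) (.assign i (.add (.reg i) (.const 1)))) s' (t + 4)
            ((p.run l s').setReg i (s'.reg i + 1)) := by
          have := Exec.seq ht (.assign i (.add (.reg i) (.const 1)) _)
          simpa [Expr.eval, Expr.cost, hi] using this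
        refine ⟨_, .while_true (by simp [Expr.eval]; omega) hb ht', ?_⟩
        rw [h1] at bt
        simp only [Expr.cost]
        rw [Nat.succ_mul]
        omega
    obtain ⟨t, ht, bt⟩ := key (s.reg l) (s.setReg i 0) (by simp [hl.1]) (by simp)
    refine ⟨_, .seq (.assign i (.const 0) s) ht, ?_⟩
    simp only [LoopProg.timeBound, Polynomial.eval_add, Polynomial.eval_C, Polynomial.eval_mul,
      Polynomial.eval_X, Expr.cost]
    omega

/-- The invariant rule for loops. -/
theorem loop_induction {l i : ℕ} {p : LoopProg} (s : State)
    (I : ℕ → State → Prop) (h0 : I 0 (s.setReg i 0))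
    (hstep : ∀ j < s.reg l, ∀ s', Frame (.loop i p) s s' → s'.reg i = j → I j s' →
      I (j + 1) ((p.run l s').setReg i (j + 1))) :
    I (s.reg l) ((LoopProg.loop i p).run l s) := by
  have key : ∀ m ≤ s.reg l,
      Frame (.loop i p) s ((fun s' => (p.run l s').setReg i (s'.reg i + 1))^[m] (s.setReg i 0)) ∧
      ((fun s' => (p.run l s').setReg i (s'.reg i + 1))^[m] (s.setReg i 0)).reg i = m ∧
      I m ((fun s' => (p.run l s').setReg i (s'.reg i + 1))^[m] (s.setReg i 0)) := by
    intro m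
    induction m with
    | zero =>
      refine fun _ => ⟨⟨fun x hx => ?_, fun x hx => rfl⟩, by simp, h0⟩
      simp only [LoopProg.writesReg, Bool.or_eq_false_iff, beq_eq_false_iff_ne] at hx
      simp [hx.1]
    | succ m ihm =>
      intro hm
      obtain ⟨hf, hr, hI⟩ := ihm (by omega)
      rw [Function.iterate_succ_apply']
      refine ⟨⟨fun x hx => ?_, fun x hx => ?_⟩, by simp [hr], ?_⟩
      · have hx' := hx
        simp only [LoopProg.writesReg, Bool.or_eq_false_iff, beq_eq_false_iff_ne] at hx'
        simp [hx'.1, (frame_run l p _).reg x hx'.2, hf.reg x hx]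
      · have hx' := hx
        simp only [LoopProg.writesArr] at hx'
        simp [(frame_run l p _).arr x hx', hf.arr x hx]
      · rw [hr]
        exact hstep m (by omega) _ hf hr hI
  exact (key _ le_rfl).2.2

/-- Run `p` if all tests in `es` succeed. -/
def LoopProg.when (es : List Expr) (p : LoopProg) : LoopProg :=
  es.foldr (fun e q => .ite e q .skip) p

theorem LoopProg.run_when (l : ℕ) (es : List Expr) (p : LoopProg) (s : State) :
    (LoopProg.when es p).run l s = if ∀ e ∈ es, e.eval s ≠ 0 then p.run l s else s := by
  induction es with
  | nil => simp [LoopProg.when]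
  | cons e es ih =>
    have : (LoopProg.when (e :: es) p).run l s =
      if e.eval s ≠ 0 then (LoopProg.when es p).run l s else s := rfl
    rw [this, ih]
    by_cases h : e.eval s = 0 <;> simp [h]

theorem Frame.trans {p : LoopProg} {s s' s'' : State} (h : Frame p s s') (h' : Frame p s' s'') :
    Frame p s s'' :=
  ⟨fun x hx => (h'.reg x hx).trans (h.reg x hx), fun x hx => (h'.arr x hx).trans (h.arr x hx)⟩

theorem Frame.mono {p q : LoopProg} {s s' : State} (h : Frame p s s')
    (hr : ∀ x, q.writesReg x = false → p.writesReg x = false)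
    (ha : ∀ x, q.writesArr x = false → p.writesArr x = false) : Frame q s s' :=
  ⟨fun x hx => h.reg x (hr x hx), fun x hx => h.arr x (ha x hx)⟩

end RAM

/-! ### Star packings as families of center-leaves pairs -/

/-- `p` is a star in `U`, given as its center and the set of its `r` leaves. -/
structure IsStar {V : Type*} (H : SimpleGraph V) (r : ℕ) (U : Set V) (p : V × Finset V) : Prop where
  center_mem : p.1 ∈ U
  leaves_subset : (p.2 : Set V) ⊆ U
  card_leaves : p.2.card = r
  adj : ∀ u ∈ p.2, H.Adj p.1 u

/-- The vertices of a star. -/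
def starVerts {V : Type*} (p : V × Finset V) : Set V := insert p.1 (p.2 : Set V)

/-- `H` has `k` disjoint stars with `r` leaves within `U`. -/
def Pack {V : Type*} (H : SimpleGraph V) (r : ℕ) (U : Set V) (k : ℕ) : Prop :=
  ∃ F : Finset (V × Finset V), F.card = k ∧ (∀ p ∈ F, IsStar H r U p) ∧
    (F : Set (V × Finset V)).PairwiseDisjoint starVerts

section Pack

variable {V : Type*} {H : SimpleGraph V} {r : ℕ} {U W : Set V}

theorem IsStar.mono {p : V × Finset V} (h : IsStar H r U p) (hU : U ⊆ W) : IsStar H r W p :=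
  ⟨hU h.1, h.2.trans hU, h.3, h.4⟩

theorem IsStar.starVerts_subset {p : V × Finset V} (h : IsStar H r U p) : starVerts p ⊆ U :=
  Set.insert_subset h.1 h.2

theorem pack_zero : Pack H r U 0 := ⟨∅, by simp⟩

theorem Pack.of_le {k k' : ℕ} (h : Pack H r U k) (hk : k' ≤ k) : Pack H r U k' := by
  obtain ⟨F, hF, h1, h2⟩ := h
  obtain ⟨F', hs, hc⟩ := Finset.exists_subset_card_eq (hk.trans hF.ge)
  exact ⟨F', hc, fun p hp => h1 p (hs hp), h2.subset (by exact_mod_cast hs)⟩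

theorem Pack.union {k k' : ℕ} (h : Pack H r U k) (h' : Pack H r W k') (hd : Disjoint U W) :
    Pack H r (U ∪ W) (k + k') := by
  classical
  obtain ⟨F, hF, h1, h2⟩ := h
  obtain ⟨F', hF', h1', h2'⟩ := h'
  have hdis : ∀ p ∈ F, ∀ q ∈ F', Disjoint (starVerts p) (starVerts q) := fun p hp q hq =>
    hd.mono (h1 p hp).starVerts_subset (h1' q hq).starVerts_subset
  refine ⟨F ∪ F', ?_, ?_, ?_⟩
  · rw [Finset.card_union_of_disjoint, hF, hF']
    rw [Finset.disjoint_left]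
    intro p hp hp'
    have := hdis p hp p hp'
    rw [disjoint_self] at this
    exact (Set.insert_nonempty _ _).ne_empty this
  · intro p hp
    rcases Finset.mem_union.1 hp with hp | hp
    exacts [(h1 p hp).mono Set.subset_union_left, (h1' p hp).mono Set.subset_union_right]
  · rw [Finset.coe_union, Set.pairwiseDisjoint_union]
    exact ⟨h2, h2', fun p hp q hq _ => hdis p hp q hq⟩

theorem IsStar.pack {p : V × Finset V} (h : IsStar H r U p) : Pack H r (starVerts p) 1 := by
  refine ⟨{p}, by simp, fun q hq => ?_, by simp⟩
  rw [Finset.mem_singleton] at hq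
  subst hq
  exact ⟨Set.mem_insert _ _, Set.subset_insert _ _, h.3, h.4⟩

end Pack

/-! ### The greedy phase -/

/-- The neighbors of `v` in `{0, …, n - 1}` outside of `S`. -/
noncomputable def freeNbrs (H : SimpleGraph ℕ) (n : ℕ) (S : Finset ℕ) (v : ℕ) : Finset ℕ := by
  classical exact (Finset.range n).filter fun u => H.Adj v u ∧ u ∉ S

theorem mem_freeNbrs {H : SimpleGraph ℕ} {n : ℕ} {S : Finset ℕ} {v u : ℕ} :
    u ∈ freeNbrs H n S v ↔ u < n ∧ H.Adj v u ∧ u ∉ S := by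
  classical simp [freeNbrs]

/-- `S` is the vertex set of a maximal family of `m` disjoint stars. -/
structure MaximalPack (H : SimpleGraph ℕ) (n r m : ℕ) (S : Finset ℕ) : Prop where
  subset : S ⊆ Finset.range n
  card : S.card = m * (r + 1)
  pack : Pack H r (S : Set ℕ) m
  maximal : ∀ v < n, v ∉ S → (freeNbrs H n S v).card < r

theorem freeNbrs_anti {H : SimpleGraph ℕ} {n : ℕ} {S S' : Finset ℕ} (h : S ⊆ S') (v : ℕ) :
    freeNbrs H n S' v ⊆ freeNbrs H n S v := fun u hu => by
  rw [mem_freeNbrs] at hu ⊢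
  exact ⟨hu.1, hu.2.1, fun hu' => hu.2.2 (h hu')⟩

namespace RAM

open LoopProg

/-- Registers `0`, …, `3` hold the length of the input word, the parameter, the number of vertices,
and the number of leaves. Memory `1` holds the adjacency matrix, memory `2` the row offsets. -/
structure HoldsGraph (H : SimpleGraph ℕ) (n r : ℕ) (s : State) : Prop where
  verts : s.reg 2 = n
  leaves : s.reg 3 = r
  adj : ∀ x < n, ∀ y < n, s.arr 1 (s.arr 2 x + y) ≠ 0 ↔ H.Adj x y
  adj_le : ∀ x < n, ∀ y < n, s.arr 1 (s.arr 2 x + y) ≤ 1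

theorem HoldsGraph.frame {H : SimpleGraph ℕ} {n r : ℕ} {p : LoopProg} {s s' : State}
    (h : HoldsGraph H n r s) (hf : Frame p s s')
    (hp : (p.writesReg 2 || p.writesReg 3 || p.writesArr 1 || p.writesArr 2) = false) :
    HoldsGraph H n r s' := by
  simp only [Bool.or_eq_false_iff] at hp
  obtain ⟨⟨⟨h2, h3⟩, h4⟩, h5⟩ := hp
  exact ⟨(hf.reg 2 h2).trans h.1, (hf.reg 3 h3).trans h.2,
    by rw [hf.arr 1 h4, hf.arr 2 h5]; exact h.3, by rw [hf.arr 1 h4, hf.arr 2 h5]; exact h.4⟩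

/-- Adjacency of the vertices in registers `x` and `y`. -/
def adjE (x y : ℕ) : Expr := .get 1 (.add (.get 2 (.reg x)) (.reg y))

/-- The test `e = 0`. -/
def isZero (e : Expr) : Expr := .sub (.const 1) e

/-- Add one to a register. -/
def inc (i : ℕ) : LoopProg := .assign i (.add (.reg i) (.const 1))

/-- Count in register `c` for how many values of register `u` all tests succeed. -/
def countLoop (c u : ℕ) (es : List Expr) : LoopProg :=
  .seq (.assign c (.const 0)) (.loop u (.when es (inc c)))

-- The tests need to decide `P j` only in states that agree with `s` outside of what the counting
-- loop writes, so they may read all the data computed before.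
open Classical in
theorem countLoop_run {l c u : ℕ} {es : List Expr} {s : State} (hcu : c ≠ u) (hlc : l ≠ c)
    (P : ℕ → Prop)
    (hP : ∀ j < s.reg l, ∀ s', Frame (countLoop c u es) s s' → s'.reg u = j →
      ((∀ e ∈ es, e.eval s' ≠ 0) ↔ P j)) :
    ((countLoop c u es).run l s).reg c = ((Finset.range (s.reg l)).filter P).card := by
  have hl : (s.setReg c 0).reg l = s.reg l := by simp [hlc]
  have h := loop_induction (l := l) (i := u) (p := .when es (inc c)) (s.setReg c 0)
    (fun j s' => s'.reg c = ((Finset.range j).filter P).card) (by simp [hcu]) ?_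
  · rw [hl] at h
    exact h
  · intro j hj s' hf hu hI
    rw [hl] at hj
    have hf' : Frame (countLoop c u es) s s' := by
      refine Frame.trans ((frame_run l (.assign c (.const 0)) s).mono ?_ ?_) (hf.mono ?_ ?_) <;>
        intro x hx <;> simp only [countLoop, writesReg, writesArr, Bool.or_eq_false_iff] at hx ⊢ <;>
        simp_all
    have hP' := hP j hj s' hf' hu
    rw [Finset.range_add_one, Finset.filter_insert, run_when]
    by_cases h : P j
    · rw [if_pos (hP'.2 h), if_pos h, Finset.card_insert_of_notMem (by simp)]
      simp [inc, run, Expr.eval, hcu, hI]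
    · rw [if_neg (mt hP'.1 h), if_neg h]
      simp [hcu, hI]

/-- Mark the first `r` unmarked neighbors of the vertex in register `5`. -/
def greedyMark : LoopProg :=
  .seq (.assign 6 (.const 0)) (.loop 7
    (.when [adjE 5 7, isZero (.get 3 (.reg 7)), .sub (.reg 3) (.reg 6)]
      (.seq (.store 3 (.reg 7) (.const 1)) (inc 6))))

/-- If the vertex in register `5` is unmarked and has `r` unmarked neighbors,
mark it and `r` of them. -/
def greedyStep : LoopProg :=
  .seq (countLoop 6 7 [adjE 5 7, isZero (.get 3 (.reg 7))])
    (.when [isZero (.get 3 (.reg 5)), isZero (.sub (.reg 3) (.reg 6))]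
      (.seq (.store 3 (.reg 5) (.const 1)) (.seq (inc 4) greedyMark)))

/-- Greedily mark stars; register `4` counts them. -/
def greedy : LoopProg := .loop 5 greedyStep

/-- Memory `3` is the indicator function of `S` on `{0, …, n - 1}`. -/
def Marks (n : ℕ) (s : State) (S : Finset ℕ) : Prop := ∀ v < n, s.arr 3 v = if v ∈ S then 1 else 0

/-- Invariant: while fewer than `r` vertices are marked, every free neighbor seen so far is marked.
Ending with fewer than `r` would thus mark all free neighbors, of which there are at least `r`. -/
theorem greedyMark_run {H : SimpleGraph ℕ} {n r : ℕ} {s : State} {S : Finset ℕ} {v : ℕ}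
    (hG : HoldsGraph H n r s) (hv : s.reg 5 = v) (hvn : v < n) (hS : Marks n s S)
    (hc : r ≤ (freeNbrs H n S v).card) :
    ∃ T ⊆ freeNbrs H n S v, T.card = r ∧ Marks n (greedyMark.run 2 s) (S ∪ T) := by
  have h := loop_induction (l := 2) (i := 7)
    (p := .when [adjE 5 7, isZero (.get 3 (.reg 7)), .sub (.reg 3) (.reg 6)]
      (.seq (.store 3 (.reg 7) (.const 1)) (inc 6))) (s.setReg 6 0)
    (fun j s' => ∃ T ⊆ freeNbrs H n S v, T ⊆ Finset.range j ∧ T.card = s'.reg 6 ∧ s'.reg 6 ≤ r ∧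
      Marks n s' (S ∪ T) ∧ (s'.reg 6 < r → ∀ u ∈ freeNbrs H n S v, u < j → u ∈ T)) ?_ ?_
  · have hn : (s.setReg 6 0).reg 2 = n := hG.verts
    rw [hn] at h
    obtain ⟨T, hT, _, hTc, hle, hM, hall⟩ := h
    refine ⟨T, hT, ?_, hM⟩
    by_contra hne
    have hTeq : T = freeNbrs H n S v := Finset.Subset.antisymm hT fun u hu =>
      hall (by omega) u hu (mem_freeNbrs.1 hu).1
    rw [← hTeq] at hc
    omega
  · exact ⟨∅, by simp, by simp, by simp, by simp, by simpa [Marks] using hS, by simp⟩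
  · rintro j hj s' hf h7 ⟨T, hT, hTj, hTc, hle, hM, hall⟩
    have hG' : HoldsGraph H n r s' := HoldsGraph.frame (s := s.setReg 6 0)
      ⟨hG.1, hG.2, hG.3, hG.4⟩ hf rfl
    have h5 : s'.reg 5 = v := (hf.reg 5 rfl).trans hv
    have hjn : j < n := by simpa [hG.verts] using hj
    have hjT : j ∉ T := fun h => by simpa using hTj h
    have htest : (∀ e ∈ [adjE 5 7, isZero (.get 3 (.reg 7)), .sub (.reg 3) (.reg 6)],
        e.eval s' ≠ 0) ↔ j ∈ freeNbrs H n S v ∧ s'.reg 6 < r := by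
      have hm := hM j hjn
      have ha := hG'.adj v hvn j hjn
      simp only [List.forall_mem_cons, adjE, isZero, Expr.eval, h5, h7, ha, hm, hG'.leaves,
        mem_freeNbrs, hjn, Finset.mem_union, hjT]
      by_cases hjS : j ∈ S <;> simp [hjS]; omega
    rw [run_when]
    split_ifs with hif
    · obtain ⟨hj1, hj2⟩ := htest.1 hif
      refine ⟨insert j T, Finset.insert_subset hj1 hT, ?_, ?_, ?_, ?_, ?_⟩
      · rw [Finset.range_add_one]
        exact Finset.insert_subset_insert _ hTj
      · rw [Finset.card_insert_of_notMem hjT, hTc]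
        simp [run, inc, Expr.eval]
      · simpa [run, inc, Expr.eval] using hj2
      · intro w hw
        have := hM w hw
        simp only [run, inc, Expr.eval, h7, State.setReg_arr, State.setArr_arr, if_true,
          Function.update_apply, this]
        by_cases hwj : w = j <;> simp [hwj]
      · intro _ u hu huj
        rcases Nat.lt_succ_iff_lt_or_eq.1 huj with h | h
        · exact Finset.mem_insert_of_mem (hall hj2 u hu h)
        · simp [h]
    · refine ⟨T, hT, hTj.trans (by simp), by simpa using hTc, by simpa using hle,
        by simpa [Marks] using hM, ?_⟩
      intro hlt u hu huj
      replace hlt : s'.reg 6 < r := by simpa using hlt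
      rcases Nat.lt_succ_iff_lt_or_eq.1 huj with h | h
      · exact hall hlt u hu h
      · exact absurd (htest.2 ⟨h ▸ hu, hlt⟩) hif

/-- One pass over the possible centers suffices: free neighborhoods only shrink as `S` grows, so a
vertex that once failed to be a center fails forever. -/
theorem greedy_run {H : SimpleGraph ℕ} {n r : ℕ} {s : State}
    (hG : HoldsGraph H n r s) (h4 : s.reg 4 = 0) (hS : Marks n s ∅) :
    ∃ S, Marks n (greedy.run 2 s) S ∧ MaximalPack H n r ((greedy.run 2 s).reg 4) S := by
  have h := loop_induction (l := 2) (i := 5) (p := greedyStep) s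
    (fun j s' => ∃ S, Marks n s' S ∧ S ⊆ Finset.range n ∧ S.card = s'.reg 4 * (r + 1) ∧
      Pack H r (S : Set ℕ) (s'.reg 4) ∧ ∀ v < j, v ∉ S → (freeNbrs H n S v).card < r) ?_ ?_
  · obtain ⟨S, h1, h2, h3, h4, h5⟩ := h
    exact ⟨S, h1, h2, h3, h4, hG.verts ▸ h5⟩
  · exact ⟨∅, hS, by simp, by simp [h4], by simp [h4, pack_zero], by simp⟩
  · rintro v hv s' hf h5 ⟨S, hM, hSn, hSc, hSp, hSm⟩
    have hG' : HoldsGraph H n r s' := hG.frame hf rfl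
    rw [hG.verts] at hv
    set s₁ := (countLoop 6 7 [adjE 5 7, isZero (.get 3 (.reg 7))]).run 2 s' with hs₁
    have hf₁ := frame_run 2 (countLoop 6 7 [adjE 5 7, isZero (.get 3 (.reg 7))]) s'
    rw [← hs₁] at hf₁
    have hG₁ : HoldsGraph H n r s₁ := hG'.frame hf₁ rfl
    have hM₁ : Marks n s₁ S := by rw [Marks, hf₁.arr 3 rfl]; exact hM
    have hc₁ : s₁.reg 6 = (freeNbrs H n S v).card := by
      rw [hs₁, countLoop_run (by decide) (by decide) (fun j => H.Adj v j ∧ j ∉ S), hG'.verts]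
      · unfold freeNbrs
        congr!
      · intro j hj s'' hf'' h7
        rw [hG'.verts] at hj
        have hG'' := hG'.frame hf'' rfl
        have ha := hG''.adj v hv j hj
        have hm : s''.arr 3 j = if j ∈ S then 1 else 0 := by rw [hf''.arr 3 rfl]; exact hM j hj
        have h5'' : s''.reg 5 = v := (hf''.reg 5 rfl).trans h5
        simp only [List.forall_mem_cons, adjE, isZero, Expr.eval, h5'', h7, ha, hm]
        by_cases hjS : j ∈ S <;> simp [hjS]
    have h5₁ : s₁.reg 5 = v := (hf₁.reg 5 rfl).trans h5
    have h4₁ : s₁.reg 4 = s'.reg 4 := hf₁.reg 4 rfl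
    have hrun : greedyStep.run 2 s' = _ := run_when 2 _ _ s₁
    have htest : (∀ e ∈ [isZero (.get 3 (.reg 5)), isZero (.sub (.reg 3) (.reg 6))],
        e.eval s₁ ≠ 0) ↔ v ∉ S ∧ r ≤ (freeNbrs H n S v).card := by
      simp only [List.forall_mem_cons, isZero, Expr.eval, h5₁, hc₁, hM₁ v hv, hG₁.leaves]
      by_cases hvS : v ∈ S <;> simp [hvS]; omega
    rw [hrun]
    split_ifs with hif
    · obtain ⟨hvS, hr⟩ := htest.1 hif
      set s₂ := (s₁.setArr 3 v 1).setReg 4 (s'.reg 4 + 1) with hs₂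
      have hrun₂ : (seq (store 3 (.reg 5) (.const 1)) (seq (inc 4) greedyMark)).run 2 s₁ =
          greedyMark.run 2 s₂ := by
        simp [run, inc, Expr.eval, h5₁, h4₁, hs₂]
      have hadj : ∀ u ∈ freeNbrs H n S v, u ≠ v := fun u hu h =>
        H.irrefl (h ▸ (mem_freeNbrs.1 hu).2.1)
      -- The center is marked before its leaves are chosen; as it is not its own neighbor, its free
      -- neighborhood stays the same.
      have hfree : freeNbrs H n (insert v S) v = freeNbrs H n S v := by
        refine Finset.Subset.antisymm (freeNbrs_anti (Finset.subset_insert _ _) _) fun u hu => ?_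
        have := hadj u hu
        rw [mem_freeNbrs] at hu ⊢
        simp [hu, this]
      have hG₂ : HoldsGraph H n r s₂ :=
        ⟨by simpa [hs₂] using hG₁.1, by simpa [hs₂] using hG₁.2, by simpa [hs₂] using hG₁.3,
          by simpa [hs₂] using hG₁.4⟩
      obtain ⟨T, hT, hTc, hTM⟩ := greedyMark_run (S := insert v S) hG₂ (by simpa [hs₂] using h5₁) hv
        (by
          intro w hw
          have := hM₁ w hw
          by_cases hwv : w = v <;> simp [hs₂, hwv, this])
        (hfree.symm ▸ hr)
      rw [hfree] at hT
      have h4' : (greedyMark.run 2 s₂).reg 4 = s'.reg 4 + 1 :=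
        ((frame_run 2 greedyMark s₂).reg 4 rfl).trans (by simp [hs₂])
      have hvT : v ∉ T := fun h => hadj v (hT h) rfl
      have hST : Disjoint S (insert v T) := by
        rw [Finset.disjoint_insert_right]
        exact ⟨hvS, Finset.disjoint_right.2 fun u hu => (mem_freeNbrs.1 (hT hu)).2.2⟩
      have hU : insert v S ∪ T = S ∪ insert v T := by
        ext; simp only [Finset.mem_union, Finset.mem_insert]; tauto
      rw [hU] at hTM
      rw [hrun₂]
      have hstar : IsStar H r (starVerts (v, T)) (v, T) :=
        ⟨Set.mem_insert _ _, Set.subset_insert _ _, hTc,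
          fun u hu => (mem_freeNbrs.1 (hT hu)).2.1⟩
      refine ⟨S ∪ insert v T, hTM, ?_, ?_, ?_, ?_⟩
      · refine Finset.union_subset hSn (Finset.insert_subset (by simpa using hv) fun u hu => ?_)
        simpa using (mem_freeNbrs.1 (hT hu)).1
      · rw [Finset.card_union_of_disjoint hST, Finset.card_insert_of_notMem hvT, hSc, hTc]
        simp only [State.setReg_reg, h4']
        simp
        ring
      · have := hSp.union hstar.pack (by
          rw [starVerts]; exact_mod_cast hST)
        simp only [State.setReg_reg, h4']
        simpa [starVerts] using this
      · intro w hw hwS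
        refine (Finset.card_le_card (freeNbrs_anti Finset.subset_union_left w)).trans_lt
          (hSm w ?_ fun h => hwS (Finset.mem_union_left _ h))
        refine lt_of_le_of_ne (Nat.le_of_lt_succ hw) fun h => hwS ?_
        simp [h]
    · refine ⟨S, by simpa [Marks] using hM₁, hSn, by simpa [h4₁] using hSc, by simpa [h4₁] using hSp,
        fun w hw hwS => ?_⟩
      rcases Nat.lt_succ_iff_lt_or_eq.1 hw with h | h
      · exact hSm w h hwS
      · subst h
        by_contra hlt
        exact hif (htest.2 ⟨hwS, not_lt.1 hlt⟩)

end RAM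

/-! ### Labeling the components outside of the marked set -/

/-- The subgraph of `H` of all edges outside of `S`. -/
def freeGraph (H : SimpleGraph ℕ) (S : Finset ℕ) : SimpleGraph ℕ where
  Adj u v := H.Adj u v ∧ u ∉ S ∧ v ∉ S
  symm := ⟨fun _ _ h => ⟨h.1.symm, h.2.2, h.2.1⟩⟩
  loopless := ⟨fun _ h => H.irrefl h.1⟩

/-- `lab` labels the vertices below `n` by their components in `F`. -/
structure IsLabeling (F : SimpleGraph ℕ) (n : ℕ) (lab : ℕ → ℕ) : Prop where
  lt : ∀ w < n, lab w < n
  reachable : ∀ w < n, F.Reachable w (lab w)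
  adj : ∀ u < n, ∀ v < n, F.Adj u v → lab u = lab v

namespace RAM

open LoopProg

/-- The test `a = b`. -/
def eqE (a b : Expr) : Expr := isZero (.add (.sub a b) (.sub b a))

theorem eqE_eval_ne_zero {a b : Expr} {s : State} :
    (eqE a b).eval s ≠ 0 ↔ a.eval s = b.eval s := by
  simp only [eqE, isZero, Expr.eval]
  omega

/-- Replace the label in register `8` by the label in register `9`. -/
def relabel : LoopProg :=
  .loop 7 (.when [eqE (.get 4 (.reg 7)) (.reg 8)] (.store 4 (.reg 7) (.reg 9)))

/-- If the vertices in registers `5` and `6` form an edge of unmarked vertices,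
merge their labels. -/
def mergeStep : LoopProg :=
  .when [adjE 5 6, isZero (.get 3 (.reg 5)), isZero (.get 3 (.reg 6))]
    (.seq (.assign 8 (.get 4 (.reg 5))) (.seq (.assign 9 (.get 4 (.reg 6))) relabel))

/-- Label each vertex with its own number. -/
def labelInit : LoopProg := .loop 5 (.store 4 (.reg 5) (.reg 5))

/-- Compute component labels of the unmarked vertices in memory `4`. -/
def label : LoopProg := .seq labelInit (.loop 5 (.loop 6 mergeStep))

theorem relabel_run {l : ℕ} {s : State} (w : ℕ) (hw : w < s.reg l) :
    (relabel.run l s).arr 4 w = if s.arr 4 w = s.reg 8 then s.reg 9 else s.arr 4 w := by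
  have h := loop_induction (l := l) (i := 7)
    (p := .when [eqE (.get 4 (.reg 7)) (.reg 8)] (.store 4 (.reg 7) (.reg 9))) s
    (fun j s' => ∀ w, s'.arr 4 w =
      if w < j ∧ s.arr 4 w = s.reg 8 then s.reg 9 else s.arr 4 w) (by simp) ?_
  · rw [relabel, h w]
    simp [hw]
  · intro j hj s' hf h7 hI w
    have h8 : s'.reg 8 = s.reg 8 := hf.reg 8 rfl
    have h9 : s'.reg 9 = s.reg 9 := hf.reg 9 rfl
    have hIj := hI j
    simp only [lt_irrefl, false_and, if_false] at hIj
    rw [run_when]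
    simp only [List.forall_mem_singleton, eqE_eval_ne_zero, Expr.eval, h7, h8, hIj, run, h9,
      State.setReg_arr]
    by_cases hwj : w = j
    · subst hwj
      split_ifs <;> simp_all
    · have hlt : w < j + 1 ↔ w < j := by omega
      have := hI w
      split_ifs <;> simp_all

theorem labelInit_run {l : ℕ} {s : State} (w : ℕ) (hw : w < s.reg l) :
    (labelInit.run l s).arr 4 w = w := by
  refine loop_induction (l := l) (i := 5) (p := .store 4 (.reg 5) (.reg 5)) s
    (fun j s' => ∀ w < j, s'.arr 4 w = w) (by simp) ?_ w hw
  intro j hj s' hf h5 hI w hw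
  by_cases hwj : w = j
  · simp [run, Expr.eval, h5, hwj]
  · simp [run, Expr.eval, h5, hwj, hI w (by omega)]

/-- Relabeling a whole label class keeps equal labels equal, so the edges treated earlier stay
correct. Labels stay in the component because classes are merged only along an edge of the free
graph. -/
theorem mergeStep_run {H : SimpleGraph ℕ} {n r : ℕ} {s : State} {S : Finset ℕ} {u v : ℕ}
    (hG : HoldsGraph H n r s) (hM : Marks n s S) (hu : u < n) (hv : v < n) (h5 : s.reg 5 = u)
    (h6 : s.reg 6 = v) (hlt : ∀ w < n, s.arr 4 w < n)
    (hr : ∀ w < n, (freeGraph H S).Reachable w (s.arr 4 w)) :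
    (∀ w < n, (mergeStep.run 2 s).arr 4 w < n) ∧
    (∀ w < n, (freeGraph H S).Reachable w ((mergeStep.run 2 s).arr 4 w)) ∧
    (∀ w < n, ∀ w' < n, s.arr 4 w = s.arr 4 w' →
      (mergeStep.run 2 s).arr 4 w = (mergeStep.run 2 s).arr 4 w') ∧
    ((freeGraph H S).Adj u v → (mergeStep.run 2 s).arr 4 u = (mergeStep.run 2 s).arr 4 v) := by
  have htest : (∀ e ∈ [adjE 5 6, isZero (.get 3 (.reg 5)), isZero (.get 3 (.reg 6))],
      e.eval s ≠ 0) ↔ (freeGraph H S).Adj u v := by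
    have ha := hG.adj u hu v hv
    simp only [List.forall_mem_cons, adjE, isZero, Expr.eval, h5, h6, ha, hM u hu, hM v hv,
      freeGraph]
    by_cases huS : u ∈ S <;> by_cases hvS : v ∈ S <;> simp [huS, hvS]
  rw [mergeStep, run_when]
  split_ifs with hif
  · have hadj := htest.1 hif
    have hrun : ∀ w < n, ((seq (assign 8 (.get 4 (.reg 5)))
        (seq (assign 9 (.get 4 (.reg 6))) relabel)).run 2 s).arr 4 w =
        if s.arr 4 w = s.arr 4 u then s.arr 4 v else s.arr 4 w := by
      intro w hw
      simp only [run]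
      rw [relabel_run _ (by simpa [hG.verts] using hw)]
      simp [Expr.eval, h5, h6]
    refine ⟨fun w hw => ?_, fun w hw => ?_, fun w hw w' hw' h => ?_, fun _ => ?_⟩
    · rw [hrun w hw]
      split_ifs
      exacts [hlt v hv, hlt w hw]
    · rw [hrun w hw]
      split_ifs with h
      · exact (h ▸ hr w hw).trans ((hr u hu).symm.trans (hadj.reachable.trans (hr v hv)))
      · exact hr w hw
    · rw [hrun w hw, hrun w' hw', h]
    · rw [hrun u hu, hrun v hv]
      simp
  · exact ⟨hlt, hr, fun _ _ _ _ h => h, fun h => absurd (htest.2 h) hif⟩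

theorem label_run {H : SimpleGraph ℕ} {n r : ℕ} {s : State} {S : Finset ℕ}
    (hG : HoldsGraph H n r s) (hM : Marks n s S) :
    IsLabeling (freeGraph H S) n ((label.run 2 s).arr 4) := by
  set s₁ := labelInit.run 2 s with hs₁
  have hf₁ : Frame labelInit s s₁ := frame_run 2 _ s
  have hG₁ : HoldsGraph H n r s₁ := hG.frame hf₁ rfl
  have hM₁ : Marks n s₁ S := by rw [Marks, hf₁.arr 3 rfl]; exact hM
  have hl₁ : ∀ w < n, s₁.arr 4 w = w := fun w hw => labelInit_run w (hG.verts.symm ▸ hw)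
  have h := loop_induction (l := 2) (i := 5) (p := .loop 6 mergeStep) s₁
    (fun j s' => (∀ w < n, s'.arr 4 w < n) ∧
      (∀ w < n, (freeGraph H S).Reachable w (s'.arr 4 w)) ∧
      ∀ u < n, ∀ v < n, (freeGraph H S).Adj u v → u < j → s'.arr 4 u = s'.arr 4 v) ?_ ?_
  · rw [hG₁.verts] at h
    exact ⟨h.1, h.2.1, fun u hu v hv ha => h.2.2 u hu v hv ha hu⟩
  · refine ⟨fun w hw => ?_, fun w hw => ?_, by simp⟩
    · simpa [hl₁ w hw] using hw
    · simp [hl₁ w hw]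
  · rintro u hu s₂ hf₂ h5 ⟨hlt, hr, hI⟩
    rw [hG₁.verts] at hu
    have hG₂ := hG₁.frame hf₂ rfl
    have h := loop_induction (l := 2) (i := 6) (p := mergeStep) s₂
      (fun j s' => (∀ w < n, s'.arr 4 w < n) ∧
        (∀ w < n, (freeGraph H S).Reachable w (s'.arr 4 w)) ∧
        (∀ u' < n, ∀ v < n, (freeGraph H S).Adj u' v → u' < u → s'.arr 4 u' = s'.arr 4 v) ∧
        ∀ v < n, (freeGraph H S).Adj u v → v < j → s'.arr 4 u = s'.arr 4 v) ?_ ?_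
    · rw [hG₂.verts] at h
      obtain ⟨h1, h2, h3, h4⟩ := h
      refine ⟨h1, h2, fun u' hu' v hv ha huu => ?_⟩
      rcases Nat.lt_succ_iff_lt_or_eq.1 huu with h | h
      · exact h3 u' hu' v hv ha h
      · subst h
        exact h4 v hv ha hv
    · exact ⟨hlt, hr, hI, by simp⟩
    · rintro v hv s₃ hf₃ h6 ⟨hlt', hr', hI', hJ⟩
      rw [hG₂.verts] at hv
      have hM₃ : Marks n s₃ S := by rw [Marks, hf₃.arr 3 rfl, hf₂.arr 3 rfl]; exact hM₁
      obtain ⟨h1, h2, h3, h4⟩ := mergeStep_run (hG₂.frame hf₃ rfl) hM₃ hu hv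
        ((hf₃.reg 5 rfl).trans h5) h6 hlt' hr'
      refine ⟨h1, h2, fun u' hu' v' hv' ha huu => h3 u' hu' v' hv' (hI' u' hu' v' hv' ha huu),
        fun v' hv' ha hvv => ?_⟩
      rcases Nat.lt_succ_iff_lt_or_eq.1 hvv with h | h
      · exact h3 u hu v' hv' (hJ v' hv' ha h)
      · subst h
        exact h4 ha

end RAM

/-! ### Assigning components to marked vertices by augmenting paths -/

/-- The number of `c < n` that are assigned to `x`. -/
def load (n : ℕ) (asg : ℕ → ℕ) (x : ℕ) : ℕ := ((Finset.range n).filter fun c => asg c = x).card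

/-- The three update lemmas say how moving `c` to `x` shifts one unit of load. They apply also to
the load of the dummy vertex `n`, which counts the unassigned labels. -/
theorem load_update_self {n c x : ℕ} {asg : ℕ → ℕ} (hc : c < n) (hx : asg c ≠ x) :
    load n (Function.update asg c x) x = load n asg x + 1 := by
  have : (Finset.range n).filter (fun d => Function.update asg c x d = x) =
      insert c ((Finset.range n).filter fun d => asg d = x) := by
    ext d
    by_cases hd : d = c <;> simp [hd, hc]
  rw [load, this, Finset.card_insert_of_notMem (by simp [hx])]
  rfl

theorem load_update_old {n c x : ℕ} {asg : ℕ → ℕ} (hc : c < n) (hx : asg c ≠ x) :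
    load n (Function.update asg c x) (asg c) + 1 = load n asg (asg c) := by
  have := load_update_self (asg := Function.update asg c x) (x := asg c) hc (by simpa using hx.symm)
  rw [← this]
  simp

theorem load_update_of_ne {n c x y : ℕ} {asg : ℕ → ℕ} (hx : y ≠ x) (hy : y ≠ asg c) :
    load n (Function.update asg c x) y = load n asg y := by
  unfold load
  congr 1
  ext d
  by_cases hd : d = c
  · subst hd
    simp [hx.symm, hy.symm]
  · simp [hd]

/-- Components are assigned to adjacent vertices of `S`, at most `r` to each of them;
`asg c = n` says that `c` is not assigned. -/
structure IsAssignment (H : SimpleGraph ℕ) (n r : ℕ) (S : Finset ℕ) (lab asg : ℕ → ℕ) : Prop where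
  link : ∀ c < n, asg c ≠ n → asg c ∈ S ∧ ∃ u < n, u ∉ S ∧ lab u = c ∧ H.Adj (asg c) u
  load_le : ∀ x < n, load n asg x ≤ r

/-- A tree of alternating paths from the unassigned components, which are represented by `n`.
The rank `rk x` is nonzero iff `x` is reached, and `x` is reached through the vertex `via x`. -/
structure IsSearchTree (H : SimpleGraph ℕ) (n : ℕ) (S : Finset ℕ) (lab asg rk via : ℕ → ℕ)
    (m : ℕ) : Prop where
  root : rk n = 1
  node : ∀ x < n, rk x ≠ 0 → 2 ≤ rk x ∧ rk x ≤ m ∧ x ∈ S ∧ via x < n ∧ via x ∉ S ∧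
    H.Adj x (via x) ∧ rk (asg (lab (via x))) ≠ 0 ∧ rk (asg (lab (via x))) < rk x

/-- The search can be continued from `u` to `x`. -/
def Extends (H : SimpleGraph ℕ) (S : Finset ℕ) (lab asg rk : ℕ → ℕ) (u x : ℕ) : Prop :=
  x ∈ S ∧ H.Adj x u ∧ u ∉ S ∧ rk x = 0 ∧ rk (asg (lab u)) ≠ 0

/-- The search cannot be continued. -/
def IsClosedSearch (H : SimpleGraph ℕ) (n : ℕ) (S : Finset ℕ) (lab asg rk : ℕ → ℕ) : Prop :=
  ∀ u < n, ∀ x < n, ¬ Extends H S lab asg rk u x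

/-- The number of reached vertices. -/
def reached (n : ℕ) (rk : ℕ → ℕ) : ℕ := ((Finset.range n).filter fun x => rk x ≠ 0).card

theorem reached_update {n x v : ℕ} {rk : ℕ → ℕ} (hx : x < n) (h0 : rk x = 0) (hv : v ≠ 0) :
    reached n (Function.update rk x v) = reached n rk + 1 := by
  have : (Finset.range n).filter (fun d => Function.update rk x v d ≠ 0) =
      insert x ((Finset.range n).filter fun d => rk d ≠ 0) := by
    ext d
    by_cases hd : d = x <;> simp [hd, hx, hv]
  rw [reached, this, Finset.card_insert_of_notMem (by simp [h0])]
  rfl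

theorem ne_zero_of_le_reached {n : ℕ} {rk : ℕ → ℕ} (h : n ≤ reached n rk) (x : ℕ) (hx : x < n) :
    rk x ≠ 0 := by
  have := Finset.eq_of_subset_of_card_le (Finset.filter_subset (fun x => rk x ≠ 0)
    (Finset.range n)) (by simpa [reached] using h)
  have hx' : x ∈ (Finset.range n).filter fun x => rk x ≠ 0 := by rw [this]; simpa using hx
  exact (Finset.mem_filter.1 hx').2

/-! ### The search for alternating paths -/

namespace RAM

open LoopProg

/-- The state holds a graph, the marked set, and the labels of the vertices. -/
structure HoldsLabels (H : SimpleGraph ℕ) (n r : ℕ) (S : Finset ℕ) (lab : ℕ → ℕ) (s : State) :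
    Prop extends HoldsGraph H n r s where
  marks : Marks n s S
  labels : s.arr 4 = lab

theorem HoldsLabels.frame {H : SimpleGraph ℕ} {n r : ℕ} {S : Finset ℕ} {lab : ℕ → ℕ}
    {p : LoopProg} {s s' : State} (h : HoldsLabels H n r S lab s) (hf : Frame p s s')
    (hp : (p.writesReg 2 || p.writesReg 3 || p.writesArr 1 || p.writesArr 2) = false)
    (hp' : (p.writesArr 3 || p.writesArr 4) = false) : HoldsLabels H n r S lab s' := by
  simp only [Bool.or_eq_false_iff] at hp'
  refine ⟨h.1.frame hf hp, ?_, ?_⟩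
  · rw [Marks, hf.arr 3 hp'.1]
    exact h.marks
  · rw [hf.arr 4 hp'.2]
    exact h.labels

/-- Extend the search in round `t`, held by register `10`, through the vertex in register `5` to
the vertex in register `6`. -/
def searchStep : LoopProg :=
  .when [.get 3 (.reg 6), adjE 6 5, isZero (.get 3 (.reg 5)), isZero (.get 8 (.reg 6)),
      .get 8 (.get 6 (.get 4 (.reg 5))),
      .sub (.add (.reg 10) (.const 2)) (.get 8 (.get 6 (.get 4 (.reg 5))))]
    (.seq (.store 8 (.reg 6) (.add (.reg 10) (.const 2))) (.store 9 (.reg 6) (.reg 5)))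

/-- Reset the ranks in memory `8`. -/
def resetRanks : LoopProg := .loop 5 (.store 8 (.reg 5) (.const 0))

/-- Search for alternating paths from the unassigned components. -/
def search : LoopProg :=
  .seq resetRanks (.seq (.store 8 (.reg 2) (.const 1)) (.loop 10 (.loop 5 (.loop 6 searchStep))))

theorem resetRanks_run {l : ℕ} {s : State} (w : ℕ) (hw : w < s.reg l) :
    (resetRanks.run l s).arr 8 w = 0 := by
  refine loop_induction (l := l) (i := 5) (p := .store 8 (.reg 5) (.const 0)) s
    (fun j s' => ∀ w < j, s'.arr 8 w = 0) (by simp) ?_ w hw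
  intro j hj s' hf h5 hI w hw
  by_cases hwj : w = j
  · simp [run, Expr.eval, h5, hwj]
  · simp [run, Expr.eval, h5, hwj, hI w (by omega)]

section

variable {H : SimpleGraph ℕ} {n r : ℕ} {S : Finset ℕ} {lab asg : ℕ → ℕ} {s : State}

theorem searchStep_run {t u x : ℕ} (hL : HoldsLabels H n r S lab s) (h6 : s.arr 6 = asg)
    (ht : s.reg 10 = t) (hu : s.reg 5 = u) (hx : s.reg 6 = x) (hun : u < n) (hxn : x < n)
    (hT : IsSearchTree H n S lab asg (s.arr 8) (s.arr 9) (t + 2)) :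
    IsSearchTree H n S lab asg ((searchStep.run 2 s).arr 8) ((searchStep.run 2 s).arr 9) (t + 2) ∧
    ((Extends H S lab asg (s.arr 8) u x ∧
        reached n ((searchStep.run 2 s).arr 8) = reached n (s.arr 8) + 1) ∨
      ((searchStep.run 2 s).arr 8 = s.arr 8 ∧
        ¬ (Extends H S lab asg (s.arr 8) u x ∧ s.arr 8 (asg (lab u)) < t + 2))) := by
  have htest : (∀ e ∈ [.get 3 (.reg 6), adjE 6 5, isZero (.get 3 (.reg 5)),
      isZero (.get 8 (.reg 6)), .get 8 (.get 6 (.get 4 (.reg 5))),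
      .sub (.add (.reg 10) (.const 2)) (.get 8 (.get 6 (.get 4 (.reg 5))))], e.eval s ≠ 0) ↔
      Extends H S lab asg (s.arr 8) u x ∧ s.arr 8 (asg (lab u)) < t + 2 := by
    have ha := hL.adj x hxn u hun
    simp only [List.forall_mem_cons, adjE, isZero, Expr.eval, hu, hx, ht, ha, hL.marks u hun,
      hL.marks x hxn, Extends, h6, hL.labels]
    by_cases huS : u ∈ S <;> by_cases hxS : x ∈ S <;>
      simp [huS, hxS, Nat.sub_eq_zero_iff_le, and_assoc]
  rw [searchStep, run_when]
  split_ifs with hif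
  · have hE := htest.1 hif
    obtain ⟨⟨hxS, hadj, huS, hx0, hr0⟩, hlt⟩ := hE
    simp only [run, Expr.eval, hx, hu, ht, State.setArr_reg, State.setArr_arr, if_true,
      show (8 : ℕ) ≠ 9 by decide, show (9 : ℕ) ≠ 8 by decide, if_false]
    -- Only an unreached vertex receives a rank, so the ranks of the tree built so far do not
    -- change.
    have hne : ∀ y, s.arr 8 y ≠ 0 → y ≠ x := fun y hy h => hy (h ▸ hx0)
    refine ⟨⟨?_, fun y hy hy0 => ?_⟩, Or.inl ⟨⟨hxS, hadj, huS, hx0, hr0⟩, ?_⟩⟩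
    · rw [Function.update_of_ne hxn.ne']
      exact hT.root
    · by_cases hyx : y = x
      · subst hyx
        simp only [Function.update_self]
        rw [Function.update_of_ne (hne _ hr0)]
        exact ⟨by omega, le_rfl, hxS, hun, huS, hadj, hr0, hlt⟩
      · rw [Function.update_of_ne hyx] at hy0 ⊢
        rw [Function.update_of_ne hyx]
        obtain ⟨h1, h2, h3, h4, h5, h6, h7, h8⟩ := hT.node y hy hy0
        rw [Function.update_of_ne (hne _ h7)]
        exact ⟨h1, h2, h3, h4, h5, h6, h7, h8⟩
    · exact reached_update hxn hx0 (by omega)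
  · exact ⟨hT, Or.inr ⟨rfl, fun h => hif (htest.2 h)⟩⟩

/-- A round either reaches a new vertex or shows that nothing can be reached any more. The rank test
in `searchStep` makes ranks increase strictly along the tree, so following `via` must end at the
root. -/
theorem search_round {t : ℕ} (hL : HoldsLabels H n r S lab s) (h6 : s.arr 6 = asg)
    (hlab : ∀ w < n, lab w < n) (hasg : ∀ c < n, asg c ≤ n)
    (ht : s.reg 10 = t) (hT : IsSearchTree H n S lab asg (s.arr 8) (s.arr 9) (t + 1)) :
    ∀ s', s' = (LoopProg.loop 5 (.loop 6 searchStep)).run 2 s →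
    IsSearchTree H n S lab asg (s'.arr 8) (s'.arr 9) (t + 2) ∧
    ((s'.arr 8 = s.arr 8 ∧ IsClosedSearch H n S lab asg (s.arr 8)) ∨
      (¬ IsClosedSearch H n S lab asg (s.arr 8) ∧ reached n (s.arr 8) < reached n (s'.arr 8))) := by
  rintro s' rfl
  -- Ranks present at the start of the round are below `t + 2`. So if the round changes nothing, the
  -- rank test never was the obstacle, and the search is closed.
  have hle : ∀ y ≤ n, s.arr 8 y < t + 2 := by
    intro y hy
    rcases hy.lt_or_eq with h | h
    · by_cases h0 : s.arr 8 y = 0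
      · omega
      · have := (hT.node y h h0).2.1
        omega
    · rw [h, hT.root]
      omega
  have hT' : IsSearchTree H n S lab asg (s.arr 8) (s.arr 9) (t + 2) :=
    ⟨hT.root, fun x hx h0 => by
      obtain ⟨h1, h2, h3⟩ := hT.node x hx h0
      exact ⟨h1, by omega, h3⟩⟩
  have h := loop_induction (l := 2) (i := 5) (p := .loop 6 searchStep) s
    (fun j s' => IsSearchTree H n S lab asg (s'.arr 8) (s'.arr 9) (t + 2) ∧
      ((s'.arr 8 = s.arr 8 ∧ ∀ u < j, ∀ x < n, ¬ Extends H S lab asg (s.arr 8) u x) ∨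
        (¬ IsClosedSearch H n S lab asg (s.arr 8) ∧
          reached n (s.arr 8) < reached n (s'.arr 8)))) ⟨hT', Or.inl ⟨rfl, by simp⟩⟩ ?_
  · rw [hL.verts] at h
    exact h
  · rintro u hu s₁ hf₁ h5 ⟨hT₁, hI⟩
    rw [hL.verts] at hu
    have hL₁ := hL.frame hf₁ rfl rfl
    have h := loop_induction (l := 2) (i := 6) (p := searchStep) s₁
      (fun j s' => IsSearchTree H n S lab asg (s'.arr 8) (s'.arr 9) (t + 2) ∧
        ((s'.arr 8 = s.arr 8 ∧ (∀ u' < u, ∀ x < n, ¬ Extends H S lab asg (s.arr 8) u' x) ∧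
            ∀ x < j, ¬ Extends H S lab asg (s.arr 8) u x) ∨
          (¬ IsClosedSearch H n S lab asg (s.arr 8) ∧
            reached n (s.arr 8) < reached n (s'.arr 8)))) ⟨hT₁, ?_⟩ ?_
    · rw [hL₁.verts] at h
      refine ⟨h.1, h.2.imp (fun h => ⟨h.1, fun u' hu' x hx => ?_⟩) id⟩
      rcases Nat.lt_succ_iff_lt_or_eq.1 hu' with h' | h'
      · exact h.2.1 u' h' x hx
      · exact h' ▸ h.2.2 x hx
    · exact hI.imp (fun h => ⟨h.1, h.2, by simp⟩) id
    · rintro x hx s₂ hf₂ hx6 ⟨hT₂, hJ⟩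
      rw [hL₁.verts] at hx
      have hL₂ := hL₁.frame hf₂ rfl rfl
      obtain ⟨hT₃, h⟩ := searchStep_run (asg := asg) hL₂
        ((hf₂.arr 6 rfl).trans ((hf₁.arr 6 rfl).trans h6))
        ((hf₂.reg 10 rfl).trans ((hf₁.reg 10 rfl).trans ht)) ((hf₂.reg 5 rfl).trans h5) hx6 hu hx
        hT₂
      refine ⟨hT₃, ?_⟩
      simp only [State.setReg_arr]
      rcases hJ with ⟨he, hJ1, hJ2⟩ | ⟨hnc, hlt⟩
      · rw [he] at h
        rcases h with ⟨hE, hr⟩ | ⟨he', hE⟩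
        · exact Or.inr ⟨fun hc => hc u hu x hx hE, by omega⟩
        · refine Or.inl ⟨he', hJ1, fun x' hx' => ?_⟩
          rcases Nat.lt_succ_iff_lt_or_eq.1 hx' with h' | h'
          · exact hJ2 x' h'
          · exact fun hE' => hE ⟨h' ▸ hE', hle _ (hasg _ (hlab u hu))⟩
      · refine Or.inr ⟨hnc, ?_⟩
        rcases h with ⟨_, hr⟩ | ⟨he', _⟩
        · omega
        · rwa [he']

theorem search_run (hL : HoldsLabels H n r S lab s) (h6 : s.arr 6 = asg)
    (hlab : ∀ w < n, lab w < n) (hasg : ∀ c < n, asg c ≤ n) :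
    IsSearchTree H n S lab asg ((search.run 2 s).arr 8) ((search.run 2 s).arr 9) (n + 1) ∧
    IsClosedSearch H n S lab asg ((search.run 2 s).arr 8) := by
  set s₁ := (resetRanks.run 2 s).setArr 8 n 1 with hs₁
  have hf := frame_run 2 resetRanks s
  have hL' := hL.frame hf rfl rfl
  have hrun : search.run 2 s = (LoopProg.loop 10 (.loop 5 (.loop 6 searchStep))).run 2 s₁ := by
    have h2 := hL'.verts
    simp only [search, run, hs₁, Expr.eval, h2]
  have hL₁ : HoldsLabels H n r S lab s₁ :=
    ⟨⟨hL'.verts, hL'.leaves, hL'.adj, hL'.adj_le⟩, hL'.marks, hL'.labels⟩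
  have h6₁ : s₁.arr 6 = asg := (hf.arr 6 rfl).trans h6
  have h8₁ : ∀ x < n, s₁.arr 8 x = 0 := fun x hx => by
    simp [hs₁, hx.ne, resetRanks_run x (hL.verts.symm ▸ hx)]
  have h := loop_induction (l := 2) (i := 10) (p := .loop 5 (.loop 6 searchStep)) s₁
    (fun j s' => IsSearchTree H n S lab asg (s'.arr 8) (s'.arr 9) (j + 1) ∧
      (IsClosedSearch H n S lab asg (s'.arr 8) ∨ j ≤ reached n (s'.arr 8))) ?_ ?_
  · rw [← hrun, hL₁.verts] at h
    -- If the search never closed, each of the `n` rounds reached a new vertex. Then all vertices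
    -- are reached, and the search is closed after all.
    refine ⟨h.1, h.2.elim id fun hn u _ x hx hE => ne_zero_of_le_reached hn x hx hE.2.2.2.1⟩
  · exact ⟨⟨by simp [hs₁], fun x hx h0 => absurd (h8₁ x hx) h0⟩, Or.inr (Nat.zero_le _)⟩
  · rintro t ht s' hf' h10 ⟨hT, hI⟩
    obtain ⟨hT', h⟩ := search_round (hL₁.frame hf' rfl rfl) ((hf'.arr 6 rfl).trans h6₁) hlab hasg
      h10 hT _ rfl
    refine ⟨hT', ?_⟩
    simp only [State.setReg_arr]
    rcases h with ⟨he, hc⟩ | ⟨hc, hlt⟩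
    · exact Or.inl (he ▸ hc)
    · have := hI.resolve_left hc
      exact Or.inr (by omega)

end

end RAM

/-- `asg` is an assignment of components, the reached vertices are full, and they separate
the components assigned to them and the unassigned ones from all other vertices of `S`. -/
structure IsCertificate (H : SimpleGraph ℕ) (n r : ℕ) (S : Finset ℕ) (lab asg rk : ℕ → ℕ) : Prop
    extends IsAssignment H n r S lab asg where
  mem : ∀ x < n, rk x ≠ 0 → x ∈ S
  full : ∀ x < n, rk x ≠ 0 → r ≤ load n asg x
  unassigned : ∀ c < n, asg c = n → rk n ≠ 0
  closed : IsClosedSearch H n S lab asg rk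

theorem IsAssignment.le {H : SimpleGraph ℕ} {n r : ℕ} {S : Finset ℕ} {lab asg : ℕ → ℕ}
    (h : IsAssignment H n r S lab asg) (hS : S ⊆ Finset.range n) (c : ℕ) (hc : c < n) :
    asg c ≤ n := by
  by_cases h' : asg c = n
  · exact h'.le
  · exact (Finset.mem_range.1 (hS (h.link c hc h').1)).le

/-! ### Augmentation and the certificate -/

namespace RAM

open LoopProg

/-- Find a reached vertex with less than `r` components assigned to it. -/
def findTarget : LoopProg :=
  .seq (.assign 11 (.reg 2)) (.loop 5
    (.seq (countLoop 6 7 [eqE (.get 6 (.reg 7)) (.reg 5)])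
      (.when [.get 8 (.reg 5), .sub (.reg 3) (.reg 6)] (.assign 11 (.reg 5)))))

/-- Assign to the vertex in register `11` the component through which it was reached,
and continue with the former owner of this component. -/
def augmentStep : LoopProg :=
  .when [.sub (.reg 2) (.reg 11)]
    (.seq (.assign 12 (.get 4 (.get 9 (.reg 11)))) (.seq (.assign 13 (.get 6 (.reg 12)))
      (.seq (.store 6 (.reg 12) (.reg 11)) (.assign 11 (.reg 13)))))

/-- Augment the assignment along the search tree. -/
def augment : LoopProg := .loop 10 augmentStep

/-- Search, and augment the assignment; if impossible, set register `14`. -/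
def matchStep : LoopProg :=
  .when [isZero (.reg 14)] (.seq search (.seq findTarget
    (.ite (.sub (.reg 2) (.reg 11)) augment (.assign 14 (.const 1)))))

/-- Make all components unassigned. -/
def assignInit : LoopProg := .loop 5 (.store 6 (.reg 5) (.reg 2))

/-- Compute a maximum assignment of components in memory `6`, with a certificate in
memory `8`. -/
def matching : LoopProg :=
  .seq assignInit (.seq (.loop 15 matchStep) (.when [isZero (.reg 14)] resetRanks))

variable {H : SimpleGraph ℕ} {n r : ℕ} {S : Finset ℕ} {lab asg : ℕ → ℕ} {s : State}

theorem findTarget_run (hL : HoldsLabels H n r S lab s) :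
    ((findTarget.run 2 s).reg 11 = n ∧ ∀ x < n, s.arr 8 x ≠ 0 → r ≤ load n (s.arr 6) x) ∨
    ((findTarget.run 2 s).reg 11 < n ∧ s.arr 8 ((findTarget.run 2 s).reg 11) ≠ 0 ∧
      load n (s.arr 6) ((findTarget.run 2 s).reg 11) < r) := by
  have hn : (s.setReg 11 (s.reg 2)).reg 2 = n := hL.verts
  have h := loop_induction (l := 2) (i := 5)
    (p := .seq (countLoop 6 7 [eqE (.get 6 (.reg 7)) (.reg 5)])
      (.when [.get 8 (.reg 5), .sub (.reg 3) (.reg 6)] (.assign 11 (.reg 5))))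
    (s.setReg 11 (s.reg 2))
    (fun j s' => (s'.reg 11 = n ∧ ∀ x < j, s.arr 8 x ≠ 0 → r ≤ load n (s.arr 6) x) ∨
      (s'.reg 11 < n ∧ s.arr 8 (s'.reg 11) ≠ 0 ∧ load n (s.arr 6) (s'.reg 11) < r)) ?_ ?_
  · rw [hn] at h
    exact h
  · exact Or.inl ⟨by simpa using hL.verts, by simp⟩
  · rintro x hx s₁ hf h5 hI
    rw [hn] at hx
    have hf' := frame_run 2 (countLoop 6 7 [eqE (.get 6 (.reg 7)) (.reg 5)]) s₁
    have h6₁ : s₁.arr 6 = s.arr 6 := hf.arr 6 rfl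
    have h8₁ : s₁.arr 8 = s.arr 8 := hf.arr 8 rfl
    have h3₁ : s₁.reg 3 = r := (hf.reg 3 rfl).trans hL.leaves
    have h2₁ : s₁.reg 2 = n := (hf.reg 2 rfl).trans hn
    have hc : ((countLoop 6 7 [eqE (.get 6 (.reg 7)) (.reg 5)]).run 2 s₁).reg 6 =
        load n (s.arr 6) x := by
      rw [countLoop_run (by decide) (by decide) (fun c => s.arr 6 c = x), h2₁]
      · unfold load
        congr!
      · intro c _ s₂ hf₂ h7
        simp [eqE_eval_ne_zero, Expr.eval, h7, hf₂.arr 6 rfl, h6₁, hf₂.reg 5 rfl, h5]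
    have hrun : (LoopProg.seq (countLoop 6 7 [eqE (.get 6 (.reg 7)) (.reg 5)])
      (.when [.get 8 (.reg 5), .sub (.reg 3) (.reg 6)] (.assign 11 (.reg 5)))).run 2 s₁ = _ :=
      run_when 2 _ _ _
    have htest : (∀ e ∈ ([.get 8 (.reg 5), .sub (.reg 3) (.reg 6)] : List Expr),
        e.eval ((countLoop 6 7 [eqE (.get 6 (.reg 7)) (.reg 5)]).run 2 s₁) ≠ 0) ↔
        s.arr 8 x ≠ 0 ∧ load n (s.arr 6) x < r := by
      simp [Expr.eval, hf'.reg 5 rfl, hf'.arr 8 rfl, hf'.reg 3 rfl, h5, h8₁, h3₁, hc,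
        Nat.sub_eq_zero_iff_le]
    rw [hrun]
    split_ifs with hif
    · refine Or.inr ?_
      have := htest.1 hif
      simp [run, Expr.eval, hf'.reg 5 rfl, h5, hx, this]
    · simp only [State.setReg_reg, hf'.reg 11 rfl, show (11 : ℕ) ≠ 5 by decide, if_false]
      refine hI.imp (fun h => ⟨h.1, fun y hy h0 => ?_⟩) id
      rcases Nat.lt_succ_iff_lt_or_eq.1 hy with h' | h'
      · exact h.2 y h' h0
      · subst h'
        by_contra hlt
        exact hif (htest.2 ⟨h0, not_le.1 hlt⟩)

/-- Register `11` holds a vertex `x` with spare capacity. It takes over the component through which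
it was reached, whose former owner `y` thereby gains spare capacity and becomes the next `x`. The
walk stops at the dummy owner `n`, where one label fewer is unassigned. Every intermediate
assignment is valid, and the ranks decrease strictly. -/
theorem augment_run (hL : HoldsLabels H n r S lab s) (hS : S ⊆ Finset.range n)
    (hlab : ∀ w < n, lab w < n) (hA : IsAssignment H n r S lab (s.arr 6))
    (hT : IsSearchTree H n S lab (s.arr 6) (s.arr 8) (s.arr 9) (n + 1))
    (h11 : s.reg 11 < n) (hr : s.arr 8 (s.reg 11) ≠ 0) (hl : load n (s.arr 6) (s.reg 11) < r) :
    IsAssignment H n r S lab ((augment.run 2 s).arr 6) ∧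
      load n ((augment.run 2 s).arr 6) n + 1 = load n (s.arr 6) n := by
  set rk := s.arr 8 with hrk
  set via := s.arr 9 with hvia
  set asg := s.arr 6 with hasg
  have h := loop_induction (l := 2) (i := 10) (p := augmentStep) s
    (fun j s' => IsAssignment H n r S lab (s'.arr 6) ∧
      ((s'.reg 11 = n ∧ load n (s'.arr 6) n + 1 = load n asg n) ∨
      (s'.reg 11 < n ∧ load n (s'.arr 6) n = load n asg n ∧ load n (s'.arr 6) (s'.reg 11) < r ∧
        rk (s'.reg 11) ≠ 0 ∧ rk (s'.reg 11) + j ≤ n + 1 ∧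
        ∀ x < n, rk x ≠ 0 → rk x ≤ rk (s'.reg 11) →
          s'.arr 6 (lab (via x)) = asg (lab (via x))))) ?_ ?_
  · rw [hL.verts] at h
    refine ⟨h.1, h.2.elim And.right fun h => ?_⟩
    -- After `n` steps the rank would be at most 1, whereas vertices below `n` have rank at least 2;
    -- so the walk has ended.
    have := (hT.node _ h.1 h.2.2.2.1).1
    omega
  · exact ⟨hA, Or.inr ⟨h11, rfl, hl, hr, (hT.node _ h11 hr).2.1, fun _ _ _ _ => rfl⟩⟩
  · rintro j hj s₁ hf h10 ⟨hA₁, hI⟩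
    have hL₁ := hL.frame hf rfl rfl
    rw [augmentStep, run_when]
    simp only [List.forall_mem_singleton, Expr.eval, hL₁.verts, Nat.sub_ne_zero_iff_lt]
    rcases hI with hI | ⟨hlt, hload, hless, h0, hle, hch⟩
    · rw [if_neg (by omega)]
      exact ⟨hA₁, Or.inl hI⟩
    · rw [if_pos hlt]
      obtain ⟨hr2, hrn, hxS, hvn, hvS, hadj, hp0, hplt⟩ := hT.node _ hlt h0
      have h9₁ : s₁.arr 9 = via := hf.arr 9 rfl
      generalize hx : s₁.reg 11 = x at *
      have hc : lab (via x) < n := hlab _ hvn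
      have hcx := hch x hlt h0 le_rfl
      generalize hcdef : lab (via x) = c at *
      generalize hasg₁ : s₁.arr 6 = asg₁ at *
      have hyx : asg₁ c ≠ x := by
        rw [hcx]
        intro h
        rw [h] at hplt
        omega
      have hyn : asg₁ c ≤ n := hA₁.le hS c hc
      have hxn' : n ≠ x := by omega
      have hrun : (((LoopProg.seq (.assign 12 (.get 4 (.get 9 (.reg 11))))
          (.seq (.assign 13 (.get 6 (.reg 12)))
          (.seq (.store 6 (.reg 12) (.reg 11)) (.assign 11 (.reg 13))))).run 2 s₁).setReg 10
            (j + 1)).arr 6 = Function.update asg₁ c x ∧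
          (((LoopProg.seq (.assign 12 (.get 4 (.get 9 (.reg 11))))
          (.seq (.assign 13 (.get 6 (.reg 12)))
          (.seq (.store 6 (.reg 12) (.reg 11)) (.assign 11 (.reg 13))))).run 2 s₁).setReg 10
            (j + 1)).reg 11 = asg₁ c := by
        simp [run, Expr.eval, hx, hL₁.labels, h9₁, hcdef, hasg₁]
      rw [hrun.1, hrun.2]
      refine ⟨⟨fun d hd hdn => ?_, fun z hz => ?_⟩, ?_⟩
      · by_cases hdc : d = c
        · subst hdc
          rw [Function.update_self]
          exact ⟨hxS, via x, hvn, hvS, hcdef, hadj⟩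
        · rw [Function.update_of_ne hdc] at hdn ⊢
          exact hA₁.link d hd hdn
      · by_cases hzx : z = x
        · subst hzx
          rw [load_update_self hc hyx]
          exact hless
        · by_cases hzy : z = asg₁ c
          · subst hzy
            have := load_update_old hc hyx
            have := hA₁.load_le _ hz
            omega
          · rw [load_update_of_ne hzx hzy]
            exact hA₁.load_le _ hz
      · have hold := load_update_old hc hyx
        rcases hyn.lt_or_eq with hy | hy
        · right
          have := hA₁.load_le _ hy
          refine ⟨hy, ?_, by omega, hcx ▸ hp0, by rw [hcx]; omega, fun z hz hz0 hzle => ?_⟩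
          · rw [load_update_of_ne hxn' hy.ne', hload]
          · have hzc : lab (via z) ≠ c := by
              intro h
              have := (hT.node z hz hz0).2.2.2.2.2.2.2
              rw [h, ← hcx] at this
              omega
            rw [Function.update_of_ne hzc]
            exact hch z hz hz0 (by rw [hcx] at hzle; omega)
        · left
          rw [hy] at hold
          exact ⟨hy, hold.trans hload⟩

theorem assignInit_run (hn : s.reg 2 = n) (w : ℕ) (hw : w < n) :
    (assignInit.run 2 s).arr 6 w = n := by
  have h := loop_induction (l := 2) (i := 5) (p := .store 6 (.reg 5) (.reg 2)) s
    (fun j s' => ∀ w < j, s'.arr 6 w = n) (by simp) ?_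
  · exact h w (hn.symm ▸ hw)
  · intro j hj s' hf h5 hI w hw
    have h2 : s'.reg 2 = n := (hf.reg 2 rfl).trans hn
    by_cases hwj : w = j
    · simp [run, Expr.eval, h5, hwj, h2]
    · simp [run, Expr.eval, h5, hwj, hI w (by omega)]

/-- Each successful round lowers the number of unassigned labels, initially `n`, by one. A round
without a target has a closed search in which all reached vertices are full, which is the
certificate. -/
theorem matching_run (hL : HoldsLabels H n r S lab s) (hS : S ⊆ Finset.range n)
    (hlab : ∀ w < n, lab w < n) (h14 : s.reg 14 = 0) :
    IsCertificate H n r S lab ((matching.run 2 s).arr 6) ((matching.run 2 s).arr 8) := by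
  set s₁ := assignInit.run 2 s with hs₁
  have hf₁ : Frame assignInit s s₁ := frame_run 2 _ s
  have hL₁ := hL.frame hf₁ rfl rfl
  have h6₁ : ∀ w < n, s₁.arr 6 w = n := assignInit_run hL.verts
  have h14₁ : s₁.reg 14 = 0 := (hf₁.reg 14 rfl).trans h14
  set s₂ := (LoopProg.loop 15 matchStep).run 2 s₁ with hs₂
  have hf₂ : Frame (.loop 15 matchStep) s₁ s₂ := frame_run 2 _ s₁
  have hL₂ := hL₁.frame hf₂ rfl rfl
  have h := loop_induction (l := 2) (i := 15) (p := matchStep) s₁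
    (fun j s' => IsAssignment H n r S lab (s'.arr 6) ∧
      (s'.reg 14 = 0 → load n (s'.arr 6) n + j ≤ n) ∧
      (s'.reg 14 ≠ 0 → IsCertificate H n r S lab (s'.arr 6) (s'.arr 8))) ?_ ?_
  · rw [hL₁.verts, ← hs₂] at h
    obtain ⟨hA, h0, h1⟩ := h
    have hrun : matching.run 2 s = _ := run_when 2 _ _ s₂
    rw [hrun]
    simp only [List.forall_mem_singleton, isZero, Expr.eval]
    split_ifs with hif
    -- If all `n` rounds augmented, no label is unassigned. Then the ranks that vanish on all
    -- vertices are a certificate.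
    · have hz := h0 (by omega)
      have hne : ∀ c < n, s₂.arr 6 c ≠ n := by
        intro c hc hcn
        have : 0 < load n (s₂.arr 6) n := Finset.card_pos.2 ⟨c, by simp [hc, hcn]⟩
        omega
      have hf₃ := frame_run 2 resetRanks s₂
      have h8 : ∀ x < n, (resetRanks.run 2 s₂).arr 8 x = 0 := fun x hx =>
        resetRanks_run x (hL₂.verts.symm ▸ hx)
      rw [hf₃.arr 6 rfl]
      refine ⟨hA, fun x hx h => absurd (h8 x hx) h, fun x hx h => absurd (h8 x hx) h,
        fun c hc h => absurd h (hne c hc), fun u hu x hx hE => hE.2.2.2.2 ?_⟩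
      exact h8 _ (lt_of_le_of_ne (hA.le hS _ (hlab u hu)) (hne _ (hlab u hu)))
    · exact h1 (by omega)
  · refine ⟨⟨fun c hc h => absurd (h6₁ c hc) h, fun x hx => ?_⟩, fun _ => ?_, fun h => ?_⟩
    · have : load n (s₁.arr 6) x = 0 :=
        Finset.card_eq_zero.2 (Finset.filter_eq_empty_iff.2 fun c hc => by
          rw [h6₁ c (Finset.mem_range.1 hc)]
          exact hx.ne')
      exact this.le.trans (Nat.zero_le r)
    · exact (Finset.card_filter_le _ _).trans_eq (Finset.card_range n)
    · exact absurd (by simpa using h14₁) h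
  · rintro j hj s₃ hf₃ h15 ⟨hA, h0, h1⟩
    have hL₃ := hL₁.frame hf₃ rfl rfl
    rw [matchStep, run_when]
    simp only [List.forall_mem_singleton, isZero, Expr.eval]
    split_ifs with hif
    · have h14₃ : s₃.reg 14 = 0 := by omega
      set s₄ := search.run 2 s₃ with hs₄
      have hf₄ : Frame search s₃ s₄ := frame_run 2 _ _
      have hL₄ := hL₃.frame hf₄ rfl rfl
      obtain ⟨hT, hc⟩ := search_run hL₃ rfl hlab (hA.le hS)
      rw [← hs₄] at hT hc
      set s₅ := findTarget.run 2 s₄ with hs₅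
      have hf₅ : Frame findTarget s₄ s₅ := frame_run 2 _ _
      have hL₅ := hL₄.frame hf₅ rfl rfl
      have h6₄ : s₄.arr 6 = s₃.arr 6 := hf₄.arr 6 rfl
      have h6₅ : s₅.arr 6 = s₃.arr 6 := (hf₅.arr 6 rfl).trans h6₄
      have h8₅ : s₅.arr 8 = s₄.arr 8 := hf₅.arr 8 rfl
      have h9₅ : s₅.arr 9 = s₄.arr 9 := hf₅.arr 9 rfl
      have h14₅ : s₅.reg 14 = 0 := (hf₅.reg 14 rfl).trans ((hf₄.reg 14 rfl).trans h14₃)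
      have hfind := findTarget_run hL₄
      rw [← hs₅, h6₄] at hfind
      simp only [run, Expr.eval, ← hs₄, ← hs₅, hL₅.verts, Nat.sub_ne_zero_iff_lt]
      split_ifs with hlt
      · obtain ⟨_, h80, hl⟩ := hfind.resolve_left (by omega)
        obtain ⟨hA', hload⟩ := augment_run hL₅ hS hlab (by rwa [h6₅]) (by rwa [h6₅, h8₅, h9₅]) hlt
          (by rwa [h8₅]) (by rwa [h6₅])
        have h14' : (augment.run 2 s₅).reg 14 = 0 :=
          ((frame_run 2 augment s₅).reg 14 rfl).trans h14₅
        rw [h6₅] at hload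
        have := h0 h14₃
        exact ⟨hA', fun _ => by simp only [State.setReg_arr]; omega,
          fun h => absurd (by simpa using h14') h⟩
      · obtain ⟨_, hfull⟩ := hfind.resolve_right fun h => hlt h.1
        simp only [State.setReg_arr, h6₅, h8₅]
        refine ⟨hA, fun h => by simp at h, fun _ => ⟨hA, fun x hx h => (hT.node x hx h).2.2.1, hfull,
          fun _ _ _ => by simp [hT.root], hc⟩⟩
    · exact ⟨hA, fun h => absurd h (by simp; omega), fun _ => h1 (by omega)⟩

end RAM

/-! ### Components of bounded degree without long induced paths -/

/-- The `i`-th vertex of a geodesic from `u` has distance `i` from `u`, and adjacent vertices differ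
by at most one in this distance. So a geodesic is an induced path; its first `d` vertices are used.
-/
theorem pathGraph_isIndContained_of_le_dist {V : Type*} {F : SimpleGraph V} {u v : V} {d : ℕ}
    (h : F.Reachable u v) (hd : d ≤ F.dist u v) : (SimpleGraph.pathGraph d).IsIndContained F := by
  obtain ⟨p, hp⟩ := h.exists_walk_length_eq_dist
  have hdist : ∀ i ≤ p.length, F.dist u (p.getVert i) = i := by
    intro i hi
    have h1 := F.dist_le (p.take i)
    have h2 := F.dist_le (p.drop i)
    have h3 := (p.take i).reachable.dist_triangle_left v
    rw [p.take_length] at h1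
    rw [p.drop_length] at h2
    omega
  have hadj : ∀ i j, i ≤ p.length → j ≤ p.length → F.Adj (p.getVert i) (p.getVert j) →
      i + 1 = j ∨ j + 1 = i := by
    intro i j hi hj ha
    have hne : i ≠ j := fun h => F.irrefl (h ▸ ha)
    have hij : F.dist (p.getVert i) (p.getVert j) ≤ 1 := (F.dist_le ha.toWalk).trans (by simp)
    have h1 := (p.take i).reachable.dist_triangle_left (p.getVert j)
    have h2 := (p.take j).reachable.dist_triangle_left (p.getVert i)
    rw [F.dist_comm (u := p.getVert j)] at h2
    rw [hdist i hi, hdist j hj] at h1 h2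
    omega
  refine ⟨⟨⟨fun i => p.getVert i, fun i j hij => ?_⟩, fun {i j} => ?_⟩⟩
  · have := congrArg (F.dist u) hij
    simp only at this
    rw [hdist i (by omega), hdist j (by omega)] at this
    exact Fin.ext this
  · rw [SimpleGraph.pathGraph_adj]
    constructor
    · exact hadj i j (by omega) (by omega)
    · rintro (h | h)
      · have := p.adj_getVert_succ (i := i) (by omega)
        rwa [h] at this
      · have := p.adj_getVert_succ (i := j) (by omega)
        rw [h] at this
        exact this.symm

/-- With at most `r - 1` neighbors per vertex, a ball of radius `m + 1` has at most `1 + (r - 1) r^m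
≤ r^(m+1)` vertices. -/
theorem exists_ball_card_le {V : Type*} {F : SimpleGraph V} {r : ℕ}
    (hdeg : ∀ v, ∃ N : Finset V, N.card < r ∧ ∀ u, F.Adj v u → u ∈ N) (m : ℕ) (v : V) :
    ∃ B : Finset V, B.card ≤ r ^ m ∧ ∀ u (p : F.Walk v u), p.length ≤ m → u ∈ B := by
  classical
  induction m generalizing v with
  | zero =>
    refine ⟨{v}, by simp, fun u p hp => ?_⟩
    rw [Finset.mem_singleton]
    exact (SimpleGraph.Walk.eq_of_length_eq_zero (Nat.le_zero.1 hp)).symm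
  | succ m ih =>
    obtain ⟨N, hN, hNa⟩ := hdeg v
    choose B hB hBw using ih
    refine ⟨insert v (N.biUnion B), ?_, fun u p hp => ?_⟩
    · have h1 := Finset.card_insert_le v (N.biUnion B)
      have h2 : (N.biUnion B).card ≤ N.card * r ^ m :=
        Finset.card_biUnion_le_card_mul _ _ _ fun x _ => hB x
      have h3 : 0 < r ^ m := Nat.pow_pos (by omega)
      calc _ ≤ N.card * r ^ m + r ^ m := by omega
        _ = (N.card + 1) * r ^ m := by ring
        _ ≤ r * r ^ m := Nat.mul_le_mul_right _ hN
        _ = r ^ (m + 1) := by ring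
    · cases p with
      | nil => simp
      | @cons _ w _ ha q =>
        refine Finset.mem_insert_of_mem (Finset.mem_biUnion.2 ⟨w, hNa w ha, hBw w u q ?_⟩)
        simpa using hp

theorem exists_component_card_le {V : Type*} {F : SimpleGraph V} {r d : ℕ}
    (hF : ¬ (SimpleGraph.pathGraph d).IsIndContained F)
    (hdeg : ∀ v, ∃ N : Finset V, N.card < r ∧ ∀ u, F.Adj v u → u ∈ N) (v : V) :
    ∃ B : Finset V, B.card ≤ r ^ d ∧ ∀ u, F.Reachable v u → u ∈ B := by
  obtain ⟨B, hB, h⟩ := exists_ball_card_le hdeg d v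
  refine ⟨B, hB, fun u hu => ?_⟩
  obtain ⟨p, hp⟩ := hu.exists_walk_length_eq_dist
  refine h u p ?_
  by_contra hlt
  exact hF (pathGraph_isIndContained_of_le_dist hu (by omega))

/-- A path on at least two vertices has no isolated vertex. Hence an induced copy cannot use the
isolated vertices that `freeGraph` and `natGraph` introduce. -/
theorem exists_pathGraph_adj {d : ℕ} (hd : 2 ≤ d) (i : Fin d) :
    ∃ j, (SimpleGraph.pathGraph d).Adj i j := by
  by_cases hi : i.val = 0
  · exact ⟨⟨1, by omega⟩, SimpleGraph.pathGraph_adj.2 (Or.inl (by simp [hi]))⟩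
  · exact ⟨⟨i.val - 1, by omega⟩, SimpleGraph.pathGraph_adj.2 (Or.inr (by simp; omega))⟩

theorem pathGraph_freeGraph {H : SimpleGraph ℕ} {S : Finset ℕ} {d : ℕ} (hd : 2 ≤ d)
    (h : ¬ (SimpleGraph.pathGraph d).IsIndContained H) :
    ¬ (SimpleGraph.pathGraph d).IsIndContained (freeGraph H S) := by
  rintro ⟨f⟩
  have hS : ∀ i, f i ∉ S := by
    intro i
    obtain ⟨j, hj⟩ := exists_pathGraph_adj hd i
    exact (f.map_rel_iff.2 hj).2.1
  refine h ⟨⟨f.toEmbedding, fun {i j} => ?_⟩⟩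
  exact ⟨fun ha => f.map_rel_iff.1 ⟨ha, hS i, hS j⟩, fun ha => (f.map_rel_iff.2 ha).1⟩

/-! ### The kernel -/

/-- A vertex of `S`, or the vertex of `S` to which the component of `v` is assigned. -/
def owner (S : Finset ℕ) (lab asg : ℕ → ℕ) (v : ℕ) : ℕ := if v ∈ S then v else asg (lab v)

/-- The vertices that are kept. -/
def kept (n : ℕ) (S : Finset ℕ) (lab asg rk : ℕ → ℕ) : Finset ℕ :=
  (Finset.range n).filter fun v => rk (owner S lab asg v) = 0

/-- The vertices of `S` that are reached. -/
def full (n : ℕ) (rk : ℕ → ℕ) : Finset ℕ := (Finset.range n).filter fun v => rk v ≠ 0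

theorem mem_kept {n : ℕ} {S : Finset ℕ} {lab asg rk : ℕ → ℕ} {v : ℕ} :
    v ∈ kept n S lab asg rk ↔ v < n ∧ rk (owner S lab asg v) = 0 := by
  simp [kept]

theorem mem_full {n : ℕ} {rk : ℕ → ℕ} {v : ℕ} : v ∈ full n rk ↔ v < n ∧ rk v ≠ 0 := by
  simp [full]

theorem Pack.mono {V : Type*} {H : SimpleGraph V} {r k : ℕ} {U W : Set V} (h : Pack H r U k)
    (hU : U ⊆ W) : Pack H r W k := by
  obtain ⟨F, hF, h1, h2⟩ := h
  exact ⟨F, hF, fun p hp => (h1 p hp).mono hU, h2⟩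

/-- Deleting a set of vertices destroys at most that many disjoint stars. -/
theorem Pack.avoid {V : Type*} {H : SimpleGraph V} {r k : ℕ} {U : Set V} (h : Pack H r U k)
    (D : Finset V) : Pack H r (U \ D) (k - D.card) := by
  classical
  obtain ⟨F, hF, h1, h2⟩ := h
  set F' := F.filter fun p => Disjoint (starVerts p) (D : Set V) with hF'
  have hcard : (F.filter fun p => ¬ Disjoint (starVerts p) (D : Set V)).card ≤ D.card := by
    have hx : ∀ p : V × Finset V, ∃ x, ¬ Disjoint (starVerts p) (D : Set V) →
        x ∈ starVerts p ∧ x ∈ D := by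
      intro p
      by_cases hp : Disjoint (starVerts p) (D : Set V)
      · exact ⟨p.1, fun h => absurd hp h⟩
      · obtain ⟨x, hx⟩ := Set.not_disjoint_iff.1 hp
        exact ⟨x, fun _ => by simpa using hx⟩
    -- Sending each star that meets `D` to a vertex of `D` on it is injective, since the stars are
    -- disjoint.
    choose f hf using hx
    refine Finset.card_le_card_of_injOn f (fun p hp => ?_) fun p hp q hq hpq => ?_
    · exact (hf p (Finset.mem_filter.1 hp).2).2
    · have hp' := Finset.mem_filter.1 hp
      have hq' := Finset.mem_filter.1 hq
      by_contra hne
      exact Set.disjoint_left.1 (h2 hp'.1 hq'.1 hne) (hf p hp'.2).1 (hpq ▸ (hf q hq'.2).1)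
  have hsum := Finset.card_filter_add_card_filter_not (s := F)
    (fun p => Disjoint (starVerts p) (D : Set V))
  have hk : k - D.card ≤ F'.card := by rw [hF']; omega
  refine Pack.of_le (k := F'.card) ⟨F', rfl, fun p hp => ?_, h2.subset ?_⟩ hk
  · obtain ⟨hp, hd⟩ := Finset.mem_filter.1 hp
    have := h1 p hp
    have hd' := Set.disjoint_left.1 hd
    exact ⟨⟨this.1, hd' (Set.mem_insert _ _)⟩,
      fun u hu => ⟨this.2 hu, hd' (Set.mem_insert_of_mem _ hu)⟩, this.3, this.4⟩
  · exact_mod_cast Finset.filter_subset _ _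

/-! ### Safeness of the deletion and size of the kernel -/

section Kernel

variable {H : SimpleGraph ℕ} {n r m : ℕ} {S : Finset ℕ} {lab asg rk : ℕ → ℕ}

theorem notMem_of_notMem_kept {v : ℕ} (hv : v < n) (hK : v ∉ kept n S lab asg rk)
    (hD : v ∉ full n rk) : v ∉ S ∧ rk (asg (lab v)) ≠ 0 := by
  rw [mem_kept] at hK
  rw [mem_full] at hD
  simp only [owner] at hK
  split_ifs at hK with hS
  · tauto
  · tauto

/-- The reached vertices separate the other deleted vertices from the kept ones. An edge from a
deleted component into `S` ends in a reached vertex, because the search is closed; an edge outside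
`S` stays in the component, hence with the same owner. -/
theorem notMem_kept_of_adj (hC : IsCertificate H n r S lab asg rk)
    (hlab : IsLabeling (freeGraph H S) n lab) {u v : ℕ} (hu : u < n) (hv : v < n)
    (ha : H.Adj u v) (hK : u ∉ kept n S lab asg rk) (hD : u ∉ full n rk) :
    v ∉ kept n S lab asg rk := by
  obtain ⟨huS, hr⟩ := notMem_of_notMem_kept hu hK hD
  rw [mem_kept, owner]
  rintro ⟨_, h⟩
  split_ifs at h with hvS
  · exact hC.closed u hu v hv ⟨hvS, ha.symm, huS, h, hr⟩
  · rw [← hlab.adj u hu v hv ⟨ha, huS, hvS⟩] at h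
    exact hr h

/-- Each reached vertex `x` is the center of a star with one leaf in each of `r` components assigned
to it. Leaves of different components differ, and a component has only one owner, so the stars are
disjoint. Their vertices are deleted because the owner of all of them is `x`. -/
theorem pack_full (hC : IsCertificate H n r S lab asg rk) :
    Pack H r ((Finset.range n : Set ℕ) \ kept n S lab asg rk) (full n rk).card := by
  classical
  have hleaf : ∀ c, ∃ u, c < n → asg c ≠ n → u < n ∧ u ∉ S ∧ lab u = c ∧ H.Adj (asg c) u := by
    intro c
    by_cases h : c < n ∧ asg c ≠ n
    · obtain ⟨u, hu⟩ := (hC.link c h.1 h.2).2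
      exact ⟨u, fun _ _ => hu⟩
    · exact ⟨0, fun h1 h2 => absurd ⟨h1, h2⟩ h⟩
  choose leaf hleaf using hleaf
  have hcomp : ∀ x, ∃ C : Finset ℕ, x ∈ full n rk →
      C ⊆ (Finset.range n).filter (fun c => asg c = x) ∧ C.card = r := by
    intro x
    by_cases hx : x ∈ full n rk
    · rw [mem_full] at hx
      obtain ⟨C, hC⟩ := Finset.exists_subset_card_eq (hC.full x hx.1 hx.2)
      exact ⟨C, fun _ => hC⟩
    · exact ⟨∅, fun h => absurd h hx⟩
  choose C hCs hCc using hcomp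
  have hleaf' : ∀ x ∈ full n rk, ∀ c ∈ C x, asg c = x ∧ leaf c < n ∧ leaf c ∉ S ∧
      lab (leaf c) = c ∧ H.Adj x (leaf c) := by
    intro x hx c hc
    obtain ⟨h1, h2⟩ := Finset.mem_filter.1 (hCs x hx hc)
    rw [Finset.mem_range] at h1
    have := hleaf c h1 (h2 ▸ (mem_full.1 hx).1.ne)
    exact ⟨h2, h2 ▸ this⟩
  refine ⟨(full n rk).image fun x => (x, (C x).image leaf), ?_, fun p hp => ?_, ?_⟩
  · rw [Finset.card_image_of_injective]
    intro x y h
    exact (Prod.ext_iff.1 h).1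
  · obtain ⟨x, hx, rfl⟩ := Finset.mem_image.1 hp
    have hx' := mem_full.1 hx
    refine ⟨⟨by simpa using hx'.1, ?_⟩, fun u hu => ?_, ?_, fun u hu => ?_⟩
    · rw [Finset.mem_coe, mem_kept, owner, if_pos (hC.mem x hx'.1 hx'.2)]
      exact fun h => hx'.2 h.2
    · obtain ⟨c, hc, rfl⟩ := Finset.mem_image.1 (Finset.mem_coe.1 hu)
      obtain ⟨h1, h2, h3, h4, h5⟩ := hleaf' x hx c hc
      refine ⟨by simpa using h2, ?_⟩
      rw [Finset.mem_coe, mem_kept, owner, if_neg h3, h4, h1]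
      exact fun h => hx'.2 h.2
    · rw [Finset.card_image_of_injOn, hCc x hx]
      intro c hc c' hc' h
      rw [← (hleaf' x hx c hc).2.2.2.1, ← (hleaf' x hx c' hc').2.2.2.1, h]
    · obtain ⟨c, hc, rfl⟩ := Finset.mem_image.1 hu
      exact (hleaf' x hx c hc).2.2.2.2
  · rw [Finset.coe_image]
    rintro _ ⟨x, hx, rfl⟩ _ ⟨y, hy, rfl⟩ hne
    have hxy : x ≠ y := fun h => hne (by rw [h])
    have hmem : ∀ z ∈ full n rk, z ∈ S := fun z hz =>
      hC.mem z (mem_full.1 hz).1 (mem_full.1 hz).2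
    rw [Function.onFun, Set.disjoint_left]
    intro w hw hw'
    simp only [starVerts, Set.mem_insert_iff, Finset.coe_image, Set.mem_image,
      Finset.mem_coe] at hw hw'
    rcases hw with rfl | ⟨c, hc, rfl⟩ <;> rcases hw' with h | ⟨c', hc', h⟩
    · exact hxy h
    · exact (hleaf' y hy c' hc').2.2.1 (h ▸ hmem _ hx)
    · exact (hleaf' x hx c hc).2.2.1 (h ▸ hmem _ hy)
    · have h1 := hleaf' x hx c hc
      have h2 := hleaf' y hy c' hc'
      rw [h] at h2
      apply hxy
      rw [← h1.1, ← h2.1, ← h1.2.2.2.1, ← h2.2.2.2.1]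

/-- Forward: drop the stars that meet the full vertices. If the center of a remaining star were
deleted, all its leaves would be deleted vertices outside `S`, against maximality. If only a leaf
were deleted, separation would fail. Backward: add the stars of `pack_full`. -/
theorem pack_range_iff (hM : MaximalPack H n r m S)
    (hlab : IsLabeling (freeGraph H S) n lab) (hC : IsCertificate H n r S lab asg rk) (k : ℕ) :
    Pack H r (Finset.range n : Set ℕ) k ↔
      Pack H r (kept n S lab asg rk : Set ℕ) (k - (full n rk).card) := by
  have hKn : (kept n S lab asg rk : Set ℕ) ⊆ (Finset.range n : Set ℕ) := fun v hv => by
    simpa using (mem_kept.1 hv).1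
  constructor
  · intro h
    obtain ⟨F, hF, h1, h2⟩ := h.avoid (full n rk)
    refine ⟨F, hF, fun p hp => ?_, h2⟩
    obtain ⟨⟨hc, hcD⟩, hl, hcard, ha⟩ := h1 p hp
    have hc' : p.1 < n := by simpa using hc
    have hl' : ∀ u ∈ p.2, u < n ∧ u ∉ full n rk := fun u hu => by
      have := hl hu
      exact ⟨by simpa using this.1, this.2⟩
    have hcK : p.1 ∈ kept n S lab asg rk := by
      by_contra hK
      obtain ⟨hS, _⟩ := notMem_of_notMem_kept hc' hK hcD
      have hsub : p.2 ⊆ freeNbrs H n S p.1 := fun u hu => mem_freeNbrs.2 ⟨(hl' u hu).1, ha u hu,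
        (notMem_of_notMem_kept (hl' u hu).1
          (notMem_kept_of_adj hC hlab hc' (hl' u hu).1 (ha u hu) hK hcD) (hl' u hu).2).1⟩
      have := Finset.card_le_card hsub
      have := hM.maximal p.1 hc' hS
      omega
    refine ⟨hcK, fun u hu => ?_, hcard, ha⟩
    by_contra hK
    exact notMem_kept_of_adj hC hlab (hl' u hu).1 hc' (ha u hu).symm hK (hl' u hu).2 hcK
  · intro h
    have := h.union (pack_full hC) Set.disjoint_sdiff_right
    -- With truncated subtraction, `(k - |D|) + |D|` is at least `k`, also if `|D| > k`.
    exact (this.of_le (by omega)).mono (Set.union_subset hKn Set.sdiff_subset)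

theorem card_kept_le {d : ℕ} (hd : 2 ≤ d) (hr : 1 ≤ r)
    (hH : ¬ (SimpleGraph.pathGraph d).IsIndContained H) (hn : ∀ u v, H.Adj u v → u < n)
    (hM : MaximalPack H n r m S)
    (hlab : IsLabeling (freeGraph H S) n lab) (hC : IsCertificate H n r S lab asg rk) :
    (kept n S lab asg rk).card ≤ m * ((r + 1) * (r ^ (d + 1) + 1)) := by
  classical
  have hdeg : ∀ v, ∃ N : Finset ℕ, N.card < r ∧ ∀ u, (freeGraph H S).Adj v u → u ∈ N := by
    intro v
    by_cases hv : v < n ∧ v ∉ S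
    · exact ⟨freeNbrs H n S v, hM.maximal v hv.1 hv.2, fun u hu =>
        mem_freeNbrs.2 ⟨hn u v hu.1.symm, hu.1, hu.2.2⟩⟩
    · exact ⟨∅, by simp only [Finset.card_empty]; omega, fun u hu => absurd ⟨hn v u hu.1, hu.2.1⟩ hv⟩
  choose B hB hBr using exists_component_card_le (pathGraph_freeGraph hd hH) hdeg
  have hsub : kept n S lab asg rk ⊆
      S ∪ S.biUnion fun x => ((Finset.range n).filter fun c => asg c = x).biUnion B := by
    intro v hv
    obtain ⟨hvn, h⟩ := mem_kept.1 hv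
    rw [owner] at h
    split_ifs at h with hvS
    · exact Finset.mem_union_left _ hvS
    · have hc := hlab.lt v hvn
      -- Unassigned components belong to the dummy owner `n`, which has nonzero rank, so their
      -- vertices are not kept.
      have hne : asg (lab v) ≠ n := fun he => hC.unassigned _ hc he (he ▸ h)
      refine Finset.mem_union_right _ (Finset.mem_biUnion.2 ⟨_, (hC.link _ hc hne).1,
        Finset.mem_biUnion.2 ⟨lab v, by simpa using hc, hBr _ _ (hlab.reachable v hvn).symm⟩⟩)
  calc (kept n S lab asg rk).card ≤ S.card + S.card * (r * r ^ d) := by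
        refine (Finset.card_le_card hsub).trans ((Finset.card_union_le _ _).trans ?_)
        refine Nat.add_le_add_left (Finset.card_biUnion_le_card_mul _ _ _ fun x hx => ?_) _
        refine (Finset.card_biUnion_le_card_mul _ _ _ fun c _ => hB c).trans ?_
        exact Nat.mul_le_mul_right _ (hC.load_le x (Finset.mem_range.1 (hM.subset hx)))
    _ = m * ((r + 1) * (r ^ (d + 1) + 1)) := by
        rw [hM.card]
        ring

end Kernel

/-! ### Reading the input and writing the output -/

/-- The graph on the natural numbers with the edges of `G`. -/
abbrev natGraph {n : ℕ} (G : SimpleGraph (Fin n)) : SimpleGraph ℕ := G.map Fin.valEmbedding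

theorem natGraph_adj {n : ℕ} {G : SimpleGraph (Fin n)} {x y : ℕ} (hx : x < n) (hy : y < n) :
    (natGraph G).Adj x y ↔ G.Adj ⟨x, hx⟩ ⟨y, hy⟩ := by
  rw [SimpleGraph.map_adj]
  constructor
  · rintro ⟨u, v, h, rfl, rfl⟩
    exact h
  · exact fun h => ⟨_, _, h, rfl, rfl⟩

theorem lt_of_natGraph_adj {n : ℕ} {G : SimpleGraph (Fin n)} (x y : ℕ)
    (h : (natGraph G).Adj x y) : x < n := by
  obtain ⟨u, v, _, rfl, _⟩ := (SimpleGraph.map_adj _ _ _ _).1 h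
  exact u.2

theorem pathGraph_natGraph {n d : ℕ} {G : SimpleGraph (Fin n)} (hd : 2 ≤ d)
    (h : ¬ (SimpleGraph.pathGraph d).IsIndContained G) :
    ¬ (SimpleGraph.pathGraph d).IsIndContained (natGraph G) := by
  rintro ⟨f⟩
  have hlt : ∀ i, f i < n := fun i => by
    obtain ⟨j, hj⟩ := exists_pathGraph_adj hd i
    exact lt_of_natGraph_adj _ _ (f.map_rel_iff.2 hj)
  refine h ⟨⟨⟨fun i => ⟨f i, hlt i⟩, fun i j hij => f.injective (Fin.mk.inj hij)⟩, ?_⟩⟩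
  intro i j
  exact (natGraph_adj _ _).symm.trans f.map_rel_iff

open Classical in
theorem cell_adjWord {n : ℕ} (G : SimpleGraph (Fin n)) {x y : ℕ} (hx : x < n) (hy : y < n) :
    RAM.cell (adjWord G)[x * n + y]? = if G.Adj ⟨x, hx⟩ ⟨y, hy⟩ then 2 else 1 := by
  have hlt : x * n + y < n * n := by
    have := Nat.mul_le_mul_right n (Nat.succ_le_of_lt hx)
    rw [Nat.succ_mul] at this
    omega
  have h1 : (⟨x * n + y, hlt⟩ : Fin (n * n)).divNat = ⟨x, hx⟩ := by
    ext
    simp only [Fin.divNat]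
    rw [Nat.mul_comm, Nat.mul_add_div (by omega), Nat.div_eq_of_lt hy, Nat.add_zero]
  have h2 : (⟨x * n + y, hlt⟩ : Fin (n * n)).modNat = ⟨y, hy⟩ := by
    ext
    simp only [Fin.modNat]
    rw [Nat.mul_comm, Nat.mul_add_mod, Nat.mod_eq_of_lt hy]
  rw [adjWord, List.getElem?_ofFn, dif_pos hlt, h1, h2]
  by_cases h : G.Adj ⟨x, hx⟩ ⟨y, hy⟩ <;> simp [h, RAM.cell]

theorem length_adjWord {n : ℕ} (G : SimpleGraph (Fin n)) : (adjWord G).length = n * n := by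
  simp [adjWord]

namespace RAM

open LoopProg

/-- Compute in register `2` the square root of register `0`. -/
def sqrtLoop : LoopProg :=
  .loop 5 (.when [.sub (.reg 0) (.reg 6)]
    (.seq (.assign 6 (.add (.add (.reg 6) (.reg 2)) (.add (.reg 2) (.const 1)))) (inc 2)))

/-- Copy the input to memory `1`, as a zero-one matrix. -/
def copyLoop : LoopProg := .loop 5 (.store 1 (.reg 5) (.sub (.get 0 (.reg 5)) (.const 1)))

/-- Preprocess the input; the limit register is `0`. -/
def readInput (r : ℕ) : LoopProg := .seq (.assign 3 (.const r)) (.seq sqrtLoop copyLoop)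

/-- Compute the row offsets of the adjacency matrix. -/
def offsets : LoopProg :=
  .seq (.assign 6 (.const 0)) (.loop 5
    (.seq (.store 2 (.reg 5) (.reg 6)) (.assign 6 (.add (.reg 6) (.reg 2)))))

/-- Register `6` holds the square of register `2`, updated by `(a+1)² = a² + a + (a+1)` as there is
no multiplication. The limit `n * n` is at least `n`, so the root is found before the loop ends; it
becomes the limit register of all later phases. -/
theorem sqrtLoop_run {n : ℕ} {s : State} (h0 : s.reg 0 = n * n) (h2 : s.reg 2 = 0)
    (h6 : s.reg 6 = 0) : (sqrtLoop.run 0 s).reg 2 = n := by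
  have h := loop_induction (l := 0) (i := 5) (p := .when [.sub (.reg 0) (.reg 6)]
      (.seq (.assign 6 (.add (.add (.reg 6) (.reg 2)) (.add (.reg 2) (.const 1)))) (inc 2))) s
    (fun j s' => s'.reg 2 = min j n ∧ s'.reg 6 = s'.reg 2 * s'.reg 2) (by simp [h2, h6]) ?_
  · rw [h0] at h
    exact h.1.trans (min_eq_right (Nat.le_mul_self n))
  · rintro j hj s' hf h5 ⟨hI2, hI6⟩
    have h0' : s'.reg 0 = n * n := (hf.reg 0 rfl).trans h0
    rw [run_when]
    simp only [List.forall_mem_singleton, Expr.eval, Nat.sub_ne_zero_iff_lt, h0', hI6,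
      Nat.mul_self_lt_mul_self_iff]
    split_ifs with hif
    · simp only [run, inc, Expr.eval, State.setReg_reg]
      simp
      refine ⟨by omega, by rw [hI6]; ring⟩
    · simp only [State.setReg_reg]
      simp
      exact ⟨by omega, hI6⟩

theorem copyLoop_run {s : State} (w : ℕ) (hw : w < s.reg 0) :
    (copyLoop.run 0 s).arr 1 w = s.arr 0 w - 1 := by
  refine loop_induction (l := 0) (i := 5)
    (p := .store 1 (.reg 5) (.sub (.get 0 (.reg 5)) (.const 1))) s
    (fun j s' => ∀ w < j, s'.arr 1 w = s.arr 0 w - 1) (by simp) ?_ w hw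
  intro j hj s' hf h5 hI w hw
  have h0 : s'.arr 0 = s.arr 0 := hf.arr 0 rfl
  by_cases hwj : w = j
  · simp [run, Expr.eval, h5, hwj, h0]
  · simp [run, Expr.eval, h5, hwj, hI w (by omega)]

theorem offsets_run {n : ℕ} {s : State} (h2 : s.reg 2 = n) (w : ℕ) (hw : w < n) :
    (offsets.run 2 s).arr 2 w = w * n := by
  have h := loop_induction (l := 2) (i := 5)
    (p := .seq (.store 2 (.reg 5) (.reg 6)) (.assign 6 (.add (.reg 6) (.reg 2)))) (s.setReg 6 0)
    (fun j s' => s'.reg 6 = j * n ∧ ∀ w < j, s'.arr 2 w = w * n) (by simp) ?_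
  · have hn : (s.setReg 6 0).reg 2 = n := h2
    rw [hn] at h
    exact h.2 w hw
  · rintro j hj s' hf h5 ⟨h6, hI⟩
    have h2' : s'.reg 2 = n := (hf.reg 2 rfl).trans h2
    refine ⟨by simp [run, Expr.eval, h6, h2']; ring, fun w hw => ?_⟩
    by_cases hwj : w = j
    · simp [run, Expr.eval, h5, hwj, h6]
    · simp [run, Expr.eval, h5, hwj, hI w (by omega)]

theorem holdsGraph_input {n r k : ℕ} (G : SimpleGraph (Fin n)) :
    HoldsGraph (natGraph G) n r
      (offsets.run 2 ((readInput r).run 0 (init (adjWord G) k))) := by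
  set s₁ := (init (adjWord G) k).setReg 3 r with hs₁
  set s₂ := sqrtLoop.run 0 s₁ with hs₂
  set s₃ := copyLoop.run 0 s₂ with hs₃
  have hf₂ : Frame sqrtLoop s₁ s₂ := frame_run 0 _ _
  have hf₃ : Frame copyLoop s₂ s₃ := frame_run 0 _ _
  have hf₄ := frame_run 2 offsets s₃
  have h0₁ : s₁.reg 0 = n * n := by simp [hs₁, init, adjWord]
  have h0₂ : s₂.reg 0 = n * n := (hf₂.reg 0 rfl).trans h0₁
  have h2₂ : s₂.reg 2 = n := sqrtLoop_run h0₁ (by simp [hs₁, init]) (by simp [hs₁, init])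
  have h2₃ : s₃.reg 2 = n := (hf₃.reg 2 rfl).trans h2₂
  have hrun : (readInput r).run 0 (init (adjWord G) k) = s₃ := rfl
  have hcell : ∀ x < n, ∀ y < n, s₃.arr 1 (x * n + y) =
      RAM.cell (adjWord G)[x * n + y]? - 1 := by
    intro x hx y hy
    have hlt : x * n + y < n * n := by
      have := Nat.mul_le_mul_right n (Nat.succ_le_of_lt hx)
      rw [Nat.succ_mul] at this
      omega
    rw [hs₃, copyLoop_run _ (h0₂.symm ▸ hlt), hf₂.arr 0 rfl]
    simp [hs₁, init]
  classical
  rw [hrun]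
  refine ⟨(hf₄.reg 2 rfl).trans h2₃, ?_, ?_, ?_⟩
  · rw [hf₄.reg 3 rfl, hf₃.reg 3 rfl, hf₂.reg 3 rfl]
    simp [hs₁]
  · intro x hx y hy
    rw [offsets_run h2₃ x hx, hf₄.arr 1 rfl, hcell x hx y hy, cell_adjWord G hx hy,
      natGraph_adj hx hy]
    split_ifs with h <;> simp [h]
  · intro x hx y hy
    rw [offsets_run h2₃ x hx, hf₄.arr 1 rfl, hcell x hx y hy, cell_adjWord G hx hy]
    split_ifs with h <;> simp

/-! ### Writing the kernel -/

/-- Enumerate the kept vertices in memory `10`, their number in register `16`, and count the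
deleted marked vertices in register `17`. -/
def collect : LoopProg :=
  .loop 5 (.seq (.assign 6 (.reg 5))
    (.seq (.when [isZero (.get 3 (.reg 5))] (.assign 6 (.get 6 (.get 4 (.reg 5)))))
      (.ite (.get 8 (.reg 6)) (.when [.get 3 (.reg 5)] (inc 17))
        (.seq (.store 10 (.reg 16) (.reg 5)) (inc 16)))))

/-- Write an entry of the output. -/
def writeEntry : LoopProg :=
  .when [.sub (.reg 16) (.reg 5), .sub (.reg 16) (.reg 6)]
    (.seq (.store 0 (.reg 18)
      (.add (.get 1 (.add (.get 2 (.get 10 (.reg 5))) (.get 10 (.reg 6)))) (.const 1))) (inc 18))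

/-- Write the adjacency matrix of the subgraph induced by the kept vertices. -/
def writeMatrix : LoopProg := .loop 5 (.loop 6 writeEntry)

section

variable {H : SimpleGraph ℕ} {n r : ℕ} {S : Finset ℕ} {lab asg rk : ℕ → ℕ} {s : State}

/-- `idx` enumerates the elements below `j` of `K` in increasing order. -/
structure IsEnum (K : Finset ℕ) (j m : ℕ) (idx : ℕ → ℕ) : Prop where
  mem : ∀ i < m, idx i ∈ K ∧ idx i < j
  strictMono : ∀ i i', i < i' → i' < m → idx i < idx i'
  surj : ∀ v ∈ K, v < j → ∃ i < m, idx i = v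

theorem collect_run (hL : HoldsLabels H n r S lab s) (h6 : s.arr 6 = asg) (h8 : s.arr 8 = rk)
    (hC : IsCertificate H n r S lab asg rk) (h16 : s.reg 16 = 0) (h17 : s.reg 17 = 0) :
    IsEnum (kept n S lab asg rk) n ((collect.run 2 s).reg 16) ((collect.run 2 s).arr 10) ∧
      (collect.run 2 s).reg 17 = (full n rk).card := by
  have h := loop_induction (l := 2) (i := 5) (p := .seq (.assign 6 (.reg 5))
    (.seq (.when [isZero (.get 3 (.reg 5))] (.assign 6 (.get 6 (.get 4 (.reg 5)))))
      (.ite (.get 8 (.reg 6)) (.when [.get 3 (.reg 5)] (inc 17))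
        (.seq (.store 10 (.reg 16) (.reg 5)) (inc 16))))) s
    (fun j s' => IsEnum (kept n S lab asg rk) j (s'.reg 16) (s'.arr 10) ∧
      s'.reg 17 = (full j rk).card) ?_ ?_
  · rw [hL.verts] at h
    exact h
  · refine ⟨⟨?_, ?_, by simp⟩, ?_⟩
    · simp [h16]
    · simp [h16]
    · simp [h17, full]
  · rintro v hv s₁ hf h5 ⟨hE, h17₁⟩
    rw [hL.verts] at hv
    have hL₁ := hL.frame hf rfl rfl
    have h6₁ : s₁.arr 6 = asg := (hf.arr 6 rfl).trans h6
    have h8₁ : s₁.arr 8 = rk := (hf.arr 8 rfl).trans h8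
    have hm := hL₁.marks v hv
    have hown : (LoopProg.when [isZero (.get 3 (.reg 5))]
        (.assign 6 (.get 6 (.get 4 (.reg 5))))).run 2 (s₁.setReg 6 v) =
        s₁.setReg 6 (owner S lab asg v) := by
      rw [run_when]
      simp only [List.forall_mem_singleton, isZero, Expr.eval, State.setReg_reg,
        State.setReg_arr, h5, owner, run, hL₁.labels, h6₁]
      by_cases hvS : v ∈ S
      · simp [hvS, hm]
      · simp [hvS, hm, State.setReg]
    have hrun : ((LoopProg.seq (.assign 6 (.reg 5))
        (.seq (.when [isZero (.get 3 (.reg 5))] (.assign 6 (.get 6 (.get 4 (.reg 5)))))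
        (.ite (.get 8 (.reg 6)) (.when [.get 3 (.reg 5)] (inc 17))
        (.seq (.store 10 (.reg 16) (.reg 5)) (inc 16))))).run 2 s₁) =
        if rk (owner S lab asg v) ≠ 0 then
          (if v ∈ S then (s₁.setReg 6 (owner S lab asg v)).setReg 17 (s₁.reg 17 + 1)
            else s₁.setReg 6 (owner S lab asg v))
        else ((s₁.setReg 6 (owner S lab asg v)).setArr 10 (s₁.reg 16) v).setReg 16
          (s₁.reg 16 + 1) := by
      simp only [run, Expr.eval, h5, hown, run_when, List.forall_mem_singleton, State.setReg_arr,
        State.setReg_reg, h8₁, inc, State.setArr_reg]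
      by_cases hvS : v ∈ S <;> simp [hvS, hm]
    have hfull : (full (v + 1) rk).card = (full v rk).card + if rk v ≠ 0 then 1 else 0 := by
      rw [full, Finset.range_add_one, Finset.filter_insert]
      split_ifs with h0
      · rw [Finset.card_insert_of_notMem (by simp)]
        rfl
      · rfl
    rw [hrun]
    by_cases h0 : rk (owner S lab asg v) = 0
    · have hvK : v ∈ kept n S lab asg rk := mem_kept.2 ⟨hv, h0⟩
      -- A reached vertex lies in `S` and is its own owner, so a kept vertex never adds to the count
      -- of full vertices.
      have hrv : rk v = 0 := by
        by_contra hne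
        rw [owner, if_pos (hC.mem v hv hne)] at h0
        exact hne h0
      rw [if_neg (not_not.2 h0)]
      refine ⟨⟨fun i hi => ?_, fun i i' hii hi' => ?_, fun w hw hwv => ?_⟩, ?_⟩
      · simp at hi ⊢
        by_cases him : i = s₁.reg 16
        · simp [him, hvK]
        · have := hE.mem i (by omega)
          simp [him, this.1]
          omega
      · simp at hi' ⊢
        have him : i ≠ s₁.reg 16 := by omega
        by_cases him' : i' = s₁.reg 16
        · simp [him, him', (hE.mem i (by omega)).2]
        · simp [him, him', hE.strictMono i i' hii (by omega)]
      · simp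
        rcases Nat.lt_succ_iff_lt_or_eq.1 hwv with h | h
        · obtain ⟨i, hi, hiw⟩ := hE.surj w hw h
          exact ⟨i, by omega, by simp [hi.ne, hiw]⟩
        · exact ⟨s₁.reg 16, by simp, by simp [h]⟩
      · rw [hfull]
        simp [hrv, h17₁]
    · rw [if_pos h0]
      have hE' : IsEnum (kept n S lab asg rk) (v + 1) (s₁.reg 16) (s₁.arr 10) := by
        refine ⟨fun i hi => ⟨(hE.mem i hi).1, (hE.mem i hi).2.trans (by omega)⟩, hE.strictMono,
          fun w hw hwv => hE.surj w hw ?_⟩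
        refine lt_of_le_of_ne (Nat.le_of_lt_succ hwv) fun h => ?_
        rw [h] at hw
        exact h0 (mem_kept.1 hw).2
      by_cases hvS : v ∈ S
      · rw [if_pos hvS]
        refine ⟨by simpa using hE', ?_⟩
        rw [owner, if_pos hvS] at h0
        rw [hfull]
        simp [h0, h17₁]
      · rw [if_neg hvS]
        refine ⟨by simpa using hE', ?_⟩
        have hrv : rk v = 0 := by
          by_contra hne
          exact hvS (hC.mem v hv hne)
        rw [hfull]
        simp [hrv, h17₁]

theorem IsEnum.card_eq {K : Finset ℕ} {m : ℕ} {idx : ℕ → ℕ} (h : IsEnum K n m idx)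
    (hK : K ⊆ Finset.range n) : m = K.card := by
  have himg : (Finset.range m).image idx = K := by
    ext v
    constructor
    · intro hv
      obtain ⟨i, hi, rfl⟩ := Finset.mem_image.1 hv
      exact (h.mem i (Finset.mem_range.1 hi)).1
    · intro hv
      obtain ⟨i, hi, rfl⟩ := h.surj v hv (Finset.mem_range.1 (hK hv))
      exact Finset.mem_image.2 ⟨i, Finset.mem_range.2 hi, rfl⟩
  rw [← himg, Finset.card_image_of_injOn, Finset.card_range]
  intro i hi i' hi' hii
  simp only [Finset.coe_range, Set.mem_Iio] at hi hi'
  by_contra hne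
  rcases Nat.lt_or_gt_of_ne hne with h' | h'
  · exact (h.strictMono i i' h' hi').ne hii
  · exact (h.strictMono i' i h' hi).ne hii.symm

/-- Both loops run up to `n` and skip indices from `m` on, whence the minima in the invariants.
Entries are written consecutively, so the write position `i * m + j` needs no multiplication. -/
theorem writeMatrix_run {m : ℕ} (h2 : s.reg 2 = n) (h16 : s.reg 16 = m) (hmn : m ≤ n)
    (h18 : s.reg 18 = 0) :
    (writeMatrix.run 2 s).reg 18 = m * m ∧ ∀ i < m, ∀ j < m,
      (writeMatrix.run 2 s).arr 0 (i * m + j) = s.arr 1 (s.arr 2 (s.arr 10 i) + s.arr 10 j) + 1 := by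
  have h := loop_induction (l := 2) (i := 5) (p := .loop 6 writeEntry) s
    (fun a s' => s'.reg 18 = min a m * m ∧ ∀ i < m, ∀ j < m, i < a →
      s'.arr 0 (i * m + j) = s.arr 1 (s.arr 2 (s.arr 10 i) + s.arr 10 j) + 1) ?_ ?_
  · rw [h2, min_eq_right hmn] at h
    exact ⟨h.1, fun i hi j hj => h.2 i hi j hj (hi.trans_le hmn)⟩
  · simp [h18]
  · rintro a ha s₁ hf₁ h5 ⟨h18₁, hI⟩
    have h2₁ : s₁.reg 2 = n := (hf₁.reg 2 rfl).trans h2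
    have h := loop_induction (l := 2) (i := 6) (p := writeEntry) s₁
      (fun b s' => s'.reg 18 = min a m * m + (if a < m then min b m else 0) ∧
        ∀ i < m, ∀ j < m, i < a ∨ (i = a ∧ j < b) →
        s'.arr 0 (i * m + j) = s.arr 1 (s.arr 2 (s.arr 10 i) + s.arr 10 j) + 1) ?_ ?_
    · rw [h2₁] at h
      obtain ⟨h1, hJ⟩ := h
      simp only [State.setReg_reg, State.setReg_arr]
      refine ⟨?_, fun i hi j hj hia => hJ i hi j hj ?_⟩
      · rw [if_neg (by decide), h1]
        split_ifs with ham
        · rw [min_eq_right hmn, min_eq_left ham.le, min_eq_left (show a + 1 ≤ m from ham)]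
          ring
        · rw [min_eq_right (by omega), min_eq_right (by omega)]
          rfl
      · omega
    · simp only [State.setReg_reg, State.setReg_arr]
      refine ⟨by simp [h18₁], fun i hi j hj h => hI i hi j hj (by omega)⟩
    · rintro b hb s₂ hf₂ h6 ⟨h18₂, hJ⟩
      have h5₂ : s₂.reg 5 = a := (hf₂.reg 5 rfl).trans h5
      have h16₂ : s₂.reg 16 = m := (hf₂.reg 16 rfl).trans ((hf₁.reg 16 rfl).trans h16)
      have ha1 : s₂.arr 1 = s.arr 1 := (hf₂.arr 1 rfl).trans (hf₁.arr 1 rfl)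
      have ha2 : s₂.arr 2 = s.arr 2 := (hf₂.arr 2 rfl).trans (hf₁.arr 2 rfl)
      have ha10 : s₂.arr 10 = s.arr 10 := (hf₂.arr 10 rfl).trans (hf₁.arr 10 rfl)
      rw [writeEntry, run_when]
      have htest : (∀ e ∈ ([.sub (.reg 16) (.reg 5), .sub (.reg 16) (.reg 6)] : List Expr),
          e.eval s₂ ≠ 0) ↔ a < m ∧ b < m := by
        simp [Expr.eval, h5₂, h6, h16₂, Nat.sub_eq_zero_iff_le]
      by_cases hif : a < m ∧ b < m
      · rw [if_pos (htest.2 hif)]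
        obtain ⟨ham, hbm⟩ := hif
        rw [if_pos ham, min_eq_left ham.le, min_eq_left hbm.le] at h18₂
        refine ⟨?_, fun i hi j hj hij => ?_⟩
        · simp [run, inc, Expr.eval, h18₂, ham]
          rw [min_eq_left ham.le, min_eq_left (show b + 1 ≤ m from hbm)]
          ring
        · simp only [run, inc, Expr.eval, State.setReg_arr, State.setArr_arr, if_true, h18₂, h5₂,
            h6, ha1, ha2, ha10]
          by_cases hab : i = a ∧ j = b
          · simp [hab]
          · have hne : i * m + j ≠ a * m + b := by
              rcases hij with h | h
              · have := Nat.mul_le_mul_right m (Nat.succ_le_of_lt h)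
                rw [Nat.succ_mul] at this
                omega
              · rw [h.1]
                omega
            rw [Function.update_of_ne hne]
            exact hJ i hi j hj (by omega)
      · rw [if_neg (mt htest.1 hif)]
        refine ⟨?_, fun i hi j hj hij => hJ i hi j hj (by omega)⟩
        simp only [State.setReg_reg]
        rw [if_neg (by decide), h18₂]
        congr 1
        split_ifs with ham
        · omega
        · rfl

end

end RAM

/-! ### The kernelization -/

/-- Serves both sides of the reduction: `f` is the inclusion of `Fin n` into `ℕ` for the input and
the enumeration of the kept vertices for the output. -/
theorem hasPacking_comap_iff {V W : Type*} {H : SimpleGraph V} {f : W → V}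
    (hf : Function.Injective f) {r k : ℕ} :
    HasPacking (rStar r) (H.comap f) k ↔ Pack H r (Set.range f) k := by
  classical
  constructor
  · rintro ⟨φ, hφ⟩
    set star : Fin k → V × Finset V := fun i =>
      (f (φ i (Sum.inl 0)), Finset.univ.image fun j => f (φ i (Sum.inr j))) with hstar
    have hverts : ∀ i, starVerts (star i) = f '' Set.range (φ i) := by
      intro i
      rw [← Set.range_comp]
      ext v
      simp [hstar, starVerts, eq_comm]
    have hdis : Pairwise fun i j => Disjoint (starVerts (star i)) (starVerts (star j)) := by
      intro i j hij
      simp only [hverts]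
      exact (Set.disjoint_image_iff hf).2 (hφ hij)
    refine ⟨Finset.univ.image star, ?_, fun p hp => ?_, ?_⟩
    · rw [Finset.card_image_of_injective, Finset.card_univ, Fintype.card_fin]
      intro i j hij
      by_contra hne
      have : Disjoint (starVerts (star i)) (starVerts (star j)) := hdis hne
      rw [hij, disjoint_self] at this
      exact (Set.insert_nonempty _ _).ne_empty this
    · obtain ⟨i, _, rfl⟩ := Finset.mem_image.1 hp
      refine ⟨Set.mem_range_self _, fun u hu => ?_, ?_, fun u hu => ?_⟩
      · obtain ⟨j, _, rfl⟩ := Finset.mem_image.1 (Finset.mem_coe.1 hu)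
        exact Set.mem_range_self _
      · rw [Finset.card_image_of_injective, Finset.card_univ, Fintype.card_fin]
        intro j j' h
        exact Sum.inr_injective ((φ i).injective (hf h))
      · obtain ⟨j, _, rfl⟩ := Finset.mem_image.1 hu
        have : (rStar r).Adj (Sum.inl 0) (Sum.inr j) := by simp
        exact (φ i).toHom.map_rel this
    · rw [Finset.coe_image, Finset.coe_univ, Set.image_univ]
      rintro _ ⟨i, rfl⟩ _ ⟨j, rfl⟩ hne
      exact hdis fun h => hne (by rw [h])
  · rintro ⟨F, hF, hs, hd⟩
    have hcopy : ∀ p : F, ∃ φ : (rStar r).Copy (H.comap f),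
        f '' Set.range φ ⊆ starVerts p.1 := by
      rintro ⟨p, hp⟩
      obtain ⟨⟨c, hc⟩, hl, hcard, ha⟩ := hs p hp
      have hl' : ∀ u ∈ p.2, ∃ w, f w = u := fun u hu => hl hu
      let e : Fin r ≃ p.2 := (p.2.equivFinOfCardEq hcard).symm
      choose g hg using fun j : Fin r => hl' (e j) (e j).2
      have hadj : ∀ j, H.Adj (f c) (f (g j)) := fun j => by
        rw [hc, hg]
        exact ha _ (e j).2
      have hinj : Function.Injective g := fun i j h =>
        e.injective (Subtype.ext (by rw [← hg, ← hg, h]))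
      refine ⟨⟨⟨Sum.elim (fun _ => c) g, ?_⟩, ?_⟩, ?_⟩
      · rintro (i | i) (j | j) h
        · simp at h
        · exact hadj j
        · exact (hadj i).symm
        · simp at h
      · rintro (i | i) (j | j) h
        · rw [Subsingleton.elim i j]
        · exact absurd (hadj j) (by
            rw [show c = g j from h]
            exact H.irrefl)
        · exact absurd (hadj i) (by
            rw [show g i = c from h]
            exact H.irrefl)
        · rw [hinj h]
      · rintro _ ⟨_, ⟨x, rfl⟩, rfl⟩
        rcases x with i | i
        · exact Or.inl hc
        · refine Or.inr ?_
          change f (g i) ∈ _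
          rw [hg]
          exact (e i).2
    choose φ hφ using hcopy
    let e : Fin k ≃ F := (F.equivFinOfCardEq hF).symm
    refine ⟨fun i => φ (e i), fun i j hij => ?_⟩
    have hne : (e i).1 ≠ (e j).1 := fun h => hij (e.injective (Subtype.ext h))
    exact (Set.disjoint_image_iff hf).1
      ((hd (e i).2 (e j).2 hne).mono (hφ (e i)) (hφ (e j)))

namespace RAM

open LoopProg

/-- Set the registers for the output, which is a trivial yes-instance if the greedy packing
is large enough. -/
def finish : LoopProg :=
  .ite (.sub (.reg 1) (.reg 4))
    (.seq (.assign 0 (.reg 18)) (.assign 1 (.sub (.reg 1) (.reg 17))))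
    (.seq (.assign 0 (.const 0)) (.assign 1 (.const 0)))

/-- The kernelization after reading the input; the limit register is `2`. -/
def kernelize : LoopProg :=
  .seq offsets (.seq greedy (.seq label (.seq matching (.seq collect (.seq writeMatrix finish)))))

theorem kernelize_run {r d : ℕ} (hr : 1 ≤ r) (hd : 2 ≤ d) (I : PackingInstance d) :
    ∃ J : PackingInstance d,
      Outputs (kernelize.run 2 ((readInput r).run 0 (init (adjWord I.G) I.k)))
        (adjWord J.G) J.k ∧
      (HasPacking (rStar r) I.G I.k ↔ HasPacking (rStar r) J.G J.k) ∧ J.k ≤ I.k ∧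
      J.n ≤ (I.k - 1) * ((r + 1) * (r ^ (d + 1) + 1)) := by
  obtain ⟨n, G, hG, k⟩ := I
  dsimp only
  have hH := pathGraph_natGraph hd hG
  have hyes : HasPacking (rStar r) G k ↔ Pack (natGraph G) r (Finset.range n : Set ℕ) k := by
    have h := hasPacking_comap_iff (H := natGraph G) (f := (Fin.valEmbedding : Fin n ↪ ℕ))
      Fin.valEmbedding.injective (r := r) (k := k)
    rw [SimpleGraph.comap_map_eq] at h
    rw [h]
    have : Set.range (Fin.valEmbedding : Fin n ↪ ℕ) = (Finset.range n : Set ℕ) := by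
      ext x
      rw [Finset.mem_coe, Finset.mem_range]
      exact ⟨fun ⟨i, hi⟩ => hi ▸ i.2, fun hx => ⟨⟨x, hx⟩, rfl⟩⟩
    rw [this]
  have hg₁ := holdsGraph_input (r := r) (k := k) G
  set H := natGraph G with hHdef
  obtain ⟨s₀, hs₀⟩ : ∃ s, s = (readInput r).run 0 (init (adjWord G) k) := ⟨_, rfl⟩
  have hf₀ : Frame (readInput r) (init (adjWord G) k) s₀ := hs₀ ▸ frame_run 0 _ _
  rw [← hs₀] at hg₁ ⊢
  obtain ⟨s₁, hs₁⟩ : ∃ s, s = offsets.run 2 s₀ := ⟨_, rfl⟩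
  have hf₁ : Frame offsets s₀ s₁ := hs₁ ▸ frame_run 2 _ _
  obtain ⟨s₂, hs₂⟩ : ∃ s, s = greedy.run 2 s₁ := ⟨_, rfl⟩
  have hf₂ : Frame greedy s₁ s₂ := hs₂ ▸ frame_run 2 _ _
  obtain ⟨s₃, hs₃⟩ : ∃ s, s = label.run 2 s₂ := ⟨_, rfl⟩
  have hf₃ : Frame label s₂ s₃ := hs₃ ▸ frame_run 2 _ _
  obtain ⟨s₄, hs₄⟩ : ∃ s, s = matching.run 2 s₃ := ⟨_, rfl⟩
  have hf₄ : Frame matching s₃ s₄ := hs₄ ▸ frame_run 2 _ _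
  obtain ⟨s₅, hs₅⟩ : ∃ s, s = collect.run 2 s₄ := ⟨_, rfl⟩
  have hf₅ : Frame collect s₄ s₅ := hs₅ ▸ frame_run 2 _ _
  obtain ⟨s₆, hs₆⟩ : ∃ s, s = writeMatrix.run 2 s₅ := ⟨_, rfl⟩
  have hf₆ : Frame writeMatrix s₅ s₆ := hs₆ ▸ frame_run 2 _ _
  have hrun : kernelize.run 2 s₀ = finish.run 2 s₆ := by
    simp only [kernelize, run, hs₁, hs₂, hs₃, hs₄, hs₅, hs₆]
  rw [← hs₁] at hg₁
  obtain ⟨S, hM, hP⟩ := greedy_run hg₁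
    (by rw [hf₁.reg 4 rfl, hf₀.reg 4 rfl]; rfl)
    (fun v _ => by rw [hf₁.arr 3 rfl, hf₀.arr 3 rfl]; simp [init])
  rw [← hs₂] at hM hP
  have hg₂ : HoldsGraph H n r s₂ := hg₁.frame hf₂ rfl
  have hlab : IsLabeling (freeGraph H S) n (s₃.arr 4) := hs₃ ▸ label_run hg₂ hM
  have hL₃ : HoldsLabels H n r S (s₃.arr 4) s₃ :=
    ⟨hg₂.frame hf₃ rfl, by rw [Marks, hf₃.arr 3 rfl]; exact hM, rfl⟩
  have hC : IsCertificate H n r S (s₃.arr 4) (s₄.arr 6) (s₄.arr 8) := by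
    rw [hs₄]
    exact matching_run hL₃ hP.subset hlab.lt
      (by rw [hf₃.reg 14 rfl, hf₂.reg 14 rfl, hf₁.reg 14 rfl, hf₀.reg 14 rfl]; rfl)
  have hL₄ := hL₃.frame hf₄ rfl rfl
  obtain ⟨hE, h17⟩ := collect_run hL₄ rfl rfl hC
    (by rw [hf₄.reg 16 rfl, hf₃.reg 16 rfl, hf₂.reg 16 rfl, hf₁.reg 16 rfl, hf₀.reg 16 rfl]; rfl)
    (by rw [hf₄.reg 17 rfl, hf₃.reg 17 rfl, hf₂.reg 17 rfl, hf₁.reg 17 rfl, hf₀.reg 17 rfl]; rfl)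
  rw [← hs₅] at hE h17
  have hL₅ := hL₄.frame hf₅ rfl rfl
  set K := kept n S (s₃.arr 4) (s₄.arr 6) (s₄.arr 8) with hK
  have hKn : K ⊆ Finset.range n := fun v hv => Finset.mem_range.2 (mem_kept.1 hv).1
  have hm : s₅.reg 16 = K.card := hE.card_eq hKn
  have hmn : s₅.reg 16 ≤ n := by
    rw [hm]
    exact (Finset.card_le_card hKn).trans_eq (Finset.card_range n)
  obtain ⟨h18, hmat⟩ := writeMatrix_run hL₅.verts rfl hmn
    (by rw [hf₅.reg 18 rfl, hf₄.reg 18 rfl, hf₃.reg 18 rfl, hf₂.reg 18 rfl, hf₁.reg 18 rfl,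
      hf₀.reg 18 rfl]; rfl)
  rw [← hs₆] at h18 hmat
  have hk : s₆.reg 1 = k := by
    rw [hf₆.reg 1 rfl, hf₅.reg 1 rfl, hf₄.reg 1 rfl, hf₃.reg 1 rfl, hf₂.reg 1 rfl, hf₁.reg 1 rfl,
      hf₀.reg 1 rfl]
    rfl
  have hcnt : s₆.reg 4 = s₂.reg 4 := by
    rw [hf₆.reg 4 rfl, hf₅.reg 4 rfl, hf₄.reg 4 rfl, hf₃.reg 4 rfl]
  have h17' : s₆.reg 17 = (full n (s₄.arr 8)).card := (hf₆.reg 17 rfl).trans h17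
  rw [hrun]
  by_cases hlt : s₂.reg 4 < k
  · have hfin : finish.run 2 s₆ =
        (s₆.setReg 0 (s₅.reg 16 * s₅.reg 16)).setReg 1 (k - (full n (s₄.arr 8)).card) := by
      have : k - s₂.reg 4 ≠ 0 := by omega
      simp [finish, run, Expr.eval, hk, hcnt, this, h18, h17']
    have hmem : ∀ i : Fin (s₅.reg 16), s₅.arr 10 i ∈ K := fun i => (hE.mem i i.2).1
    have hidx : Function.Injective fun i : Fin (s₅.reg 16) => s₅.arr 10 i := by
      intro i j hij
      by_contra hne
      rcases lt_or_gt_of_ne hne with h | h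
      · exact (hE.strictMono i j h j.2).ne hij
      · exact (hE.strictMono j i h i.2).ne hij.symm
    have hrange : Set.range (fun i : Fin (s₅.reg 16) => s₅.arr 10 i) = (K : Set ℕ) := by
      ext v
      constructor
      · rintro ⟨i, rfl⟩
        exact hmem i
      · intro hv
        obtain ⟨i, hi, h⟩ := hE.surj v hv (Finset.mem_range.1 (hKn hv))
        exact ⟨⟨i, hi⟩, h⟩
    have hfree : ¬ (SimpleGraph.pathGraph d).IsIndContained
        (H.comap fun i : Fin (s₅.reg 16) => s₅.arr 10 i) := fun h =>
      hH (h.trans ⟨SimpleGraph.Embedding.comap ⟨_, hidx⟩ H⟩)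
    refine ⟨⟨s₅.reg 16, H.comap fun i => s₅.arr 10 i, hfree, k - (full n (s₄.arr 8)).card⟩,
      ?_, ?_, Nat.sub_le _ _, ?_⟩
    · rw [hfin]
      refine ⟨by simp [length_adjWord], by simp, fun p hp => ?_⟩
      simp only [State.setReg_arr]
      rw [length_adjWord] at hp
      have hpos : 0 < s₅.reg 16 := Nat.pos_of_ne_zero fun h => by simp [h] at hp
      have hi : p / s₅.reg 16 < s₅.reg 16 := Nat.div_lt_of_lt_mul hp
      have hj : p % s₅.reg 16 < s₅.reg 16 := Nat.mod_lt _ hpos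
      have hp' : p = p / s₅.reg 16 * s₅.reg 16 + p % s₅.reg 16 := (Nat.div_add_mod' _ _).symm
      classical
      generalize p / s₅.reg 16 = i at hi hp'
      generalize p % s₅.reg 16 = j at hj hp'
      subst hp'
      rw [hmat i hi j hj, cell_adjWord _ hi hj]
      have hx : s₅.arr 10 i < n := (hE.mem i hi).2
      have hy : s₅.arr 10 j < n := (hE.mem j hj).2
      -- Letters are encoded by 1 and 2, so the stored entry must be exactly 0 or 1; this is why
      -- `adj_le` is carried along.
      have h1 := hL₅.adj _ hx _ hy
      have h2 := hL₅.adj_le _ hx _ hy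
      rw [SimpleGraph.comap_adj]
      split_ifs with h
      · have := h1.2 h
        omega
      · have := mt h1.1 h
        omega
    · rw [hyes, pack_range_iff hP hlab hC, hasPacking_comap_iff hidx, hrange]
    · refine (hm.trans_le (card_kept_le hd hr hH lt_of_natGraph_adj hP hlab hC)).trans ?_
      exact Nat.mul_le_mul_right _ (by omega)
  · have hfin : finish.run 2 s₆ = (s₆.setReg 0 0).setReg 1 0 := by
      have : k - s₂.reg 4 = 0 := by omega
      simp [finish, run, Expr.eval, hk, hcnt, this]
    -- Here the greedy packing already has at least `k` stars; the output is the empty graph with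
    -- parameter 0.
    refine ⟨⟨0, ⊥, ?_, 0⟩, ?_, ?_, Nat.zero_le _, Nat.zero_le _⟩
    · rintro ⟨f⟩
      exact (f ⟨0, by omega⟩).elim0
    · rw [hfin]
      exact ⟨by simp [length_adjWord], by simp, fun p hp => by simp [length_adjWord] at hp⟩
    · rw [hyes]
      refine ⟨fun _ => ⟨fun i => i.elim0, fun i => i.elim0⟩, fun _ => ?_⟩
      exact (hP.pack.of_le (not_lt.1 hlt)).mono (by exact_mod_cast hP.subset)

end RAM

theorem theorem1 (r d : ℕ) (hr : 2 ≤ r) (hd : 3 ≤ d) :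
    ∃ κ : PackingInstance d → PackingInstance d,
      IsKernelization (starPacking r d) κ ∧
      ∀ I : PackingInstance d, (κ I).n ≤ (I.k - 1) * ((r + 1) * (r ^ (d + 1) + 1)) := by
  -- The map is obtained by choosing, for each input, an instance that the final state of the
  -- program presents.
  choose κ hout hyes hk hn using
    RAM.kernelize_run (r := r) (d := d) (by omega) (by omega)
  refine ⟨κ, ⟨?_, hyes, ?_⟩, hn⟩
  · refine ⟨.seq ((RAM.readInput r).toProg 0) (RAM.kernelize.toProg 2),
      (RAM.readInput r).timeBound + RAM.kernelize.timeBound, fun I => ?_⟩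
    obtain ⟨t₁, h₁, b₁⟩ := RAM.exec_toProg 0 (RAM.readInput r) rfl rfl
      (RAM.init (adjWord I.G) I.k)
    obtain ⟨t₂, h₂, b₂⟩ := RAM.exec_toProg 2 RAM.kernelize rfl rfl
      ((RAM.readInput r).run 0 (RAM.init (adjWord I.G) I.k))
    refine ⟨_, _, .seq h₁ h₂, ?_, hout I⟩
    have hlen : (RAM.init (adjWord I.G) I.k).reg 0 = (adjWord I.G).length := rfl
    -- The second phase is bounded by a polynomial in `n`, and `n` is at most the word length `n *
    -- n`. The bound does not depend on `k`, on which only unit-cost operations are performed.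
    have hreg : ((RAM.readInput r).run 0 (RAM.init (adjWord I.G) I.k)).reg 2 ≤
        (adjWord I.G).length := by
      rw [length_adjWord]
      have h := (RAM.holdsGraph_input (r := r) (k := I.k) I.G).verts
      rw [(RAM.frame_run 2 RAM.offsets _).reg 2 rfl] at h
      rw [h]
      exact Nat.le_mul_self _
    have mono : ∀ (p : Polynomial ℕ) {a b : ℕ}, a ≤ b → p.eval a ≤ p.eval b := by
      intro p a b hab
      rw [Polynomial.eval_eq_sum, Polynomial.eval_eq_sum]
      exact Finset.sum_le_sum fun i _ => Nat.mul_le_mul_left _ (Nat.pow_le_pow_left hab i)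
    rw [Polynomial.eval_add]
    exact Nat.add_le_add (b₁.trans (mono _ (hlen.trans_le (Nat.le_add_right _ _))))
      (b₂.trans (mono _ (hreg.trans (Nat.le_add_right _ _))))
  · refine ⟨fun k => k + ((k - 1) * ((r + 1) * (r ^ (d + 1) + 1))) *
      ((k - 1) * ((r + 1) * (r ^ (d + 1) + 1))), fun I => Nat.add_le_add (hk I) ?_⟩
    exact (length_adjWord _).trans_le (Nat.mul_le_mul (hn I) (hn I))
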